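/- Let $K$ be a finite CW complex (in particular Hausdorff) with open cells $e_\alpha$ and given characteristic maps $f_\alpha\colon B^{\dim e_\alpha}\to\overline{e_\alpha}$, where $B^m$ is the closed $m$-ball and $\partial B^0=\emptyset$. Call $K$ \emph{regular with respect to the characteristic maps} $\{f_\alpha\}$ if each $f_\alpha$ restricts to a homeomorphism from $\partial B^{\dim e_\alpha}$ onto a finite union of open cells of dimension less than $\dim e_\alpha$. The \emph{closure poset} of $K$ is the set of open cells ordered by $e_\sigma\le e_\tau$ iff $e_\sigma\subseteq\overline{e_\tau}$, with a least element $\hat 0$ adjoined; its rank function is $\mathrm{rk}(\hat 0)=0$, $\mathrm{rk}(e_\alpha)=\dim e_\alpha+1$. It is \emph{graded by cell dimension} if $\mathrm{rk}(v)=\mathrm{rk}(u)+1$ whenever $v$ covers $u$, and \emph{thin} if it is graded by cell dimension and each closed interval $[u,v]$ with $\mathrm{rk}(v)-\mathrm{rk}(u)=2$ has exactly four elements. An open interval $(u,v)=\{z: u<z<v\}$ is \emph{connected} if its order complex is connected, i.e. if it is nonempty and any two of its elements are joined by a finite sequence of elements of $(u,v)$ in which consecutive elements are comparable. Then $K$ is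 regular with respect to the characteristic maps $\{f_\alpha\}$ if and only if the following five conditions hold: 1. For each $\alpha$, $f_\alpha(B^{\dim e_\alpha})$ is a union of open cells. 2. For each $\alpha$, the preimages under $f_\alpha$ of the open cells of dimension $\dim e_\alpha-1$ form a dense subset of the boundary of $B^{\dim e_\alpha}$. 3. The closure poset of $K$ is thin, and each open interval $(u,v)$ with $u \le v$ and $\mathrm{rk}(v)-\mathrm{rk}(u)>2$ is connected. (Conditions 1 and 2 imply that the closure poset is graded by cell dimension, so that ranks make sense here.) 4. For each $\alpha$, the restriction of $f_\alpha$ to the union of the preimages of the open cells of dimension exactly $\dim e_\alpha-1$ is injective. 5. For each pair of cells with $e_\sigma\subseteq\overline{e_\alpha}$, there is a topological embedding $\iota\colon B^{\dim e_\sigma}\to B^{\dim e_\alpha}$ with $f_\sigma=f_\alpha\circ\iota$. -/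

import Mathlib

open Topology Metric Set

namespace FiniteCW

variable {X : Type*} [TopologicalSpace X]

/-- The cells of a CW complex, of all dimensions together. The characteristic maps
`RelCWComplex.map` are part of the data of the CW complex; the model of the closed `n`-ball is the
closed unit ball `closedBall 0 1` of `Fin n → ℝ`, with boundary `sphere 0 1`. -/
structure Cell (C : Set X) [CWComplex C] where
  /-- The dimension of the cell. -/
  dim : ℕ
  /-- The index of the cell among the cells of its dimension. -/
  idx : RelCWComplex.cell C dim

namespace Cell

variable {C : Set X} [CWComplex C]

/-- The characteristic map `f_α`; only its values on `closedBall 0 1` are meaningful. -/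
noncomputable def charMap (e : Cell C) : (Fin e.dim → ℝ) → X := RelCWComplex.map e.dim e.idx

/-- The open cell `e_α`, the image of the open ball. -/
def openCell (e : Cell C) : Set X := RelCWComplex.openCell e.dim e.idx

/-- The image `f_α(B)` of the whole closed ball. -/
def closedCell (e : Cell C) : Set X := RelCWComplex.closedCell e.dim e.idx

theorem openCell_nonempty (e : Cell C) : e.openCell.Nonempty :=
  RelCWComplex.openCell_nonempty e.dim e.idx

theorem eq_of_mem {s t : Cell C} {x : X} (hs : x ∈ s.openCell) (ht : x ∈ t.openCell) :
    s = t := by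
  obtain ⟨n, i⟩ := s
  obtain ⟨m, j⟩ := t
  by_contra hne
  have hne' : (⟨n, i⟩ : Σ n, RelCWComplex.cell C n) ≠ ⟨m, j⟩ := by
    intro h
    cases h
    exact hne rfl
  exact Set.disjoint_left.1 (RelCWComplex.disjoint_openCell_of_ne hne') hs ht

theorem eq_or_dim_lt [T2Space X] {s t : Cell C} (h : s.openCell ⊆ closure t.openCell) :
    s = t ∨ s.dim < t.dim := by
  obtain ⟨x, hx⟩ := s.openCell_nonempty
  have hx' : x ∈ RelCWComplex.closedCell t.dim t.idx := by
    rw [← RelCWComplex.closure_openCell_eq_closedCell]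
    exact h hx
  rw [← RelCWComplex.cellFrontier_union_openCell_eq_closedCell] at hx'
  rcases hx' with hx' | hx'
  · obtain ⟨I, hI⟩ := CWComplex.cellFrontier_subset_finite_openCell t.dim t.idx
    have hy := hI hx'
    simp only [mem_iUnion] at hy
    obtain ⟨m, hm, j, -, hj⟩ := hy
    right
    have : s = ⟨m, j⟩ := eq_of_mem hx hj
    rw [this]
    exact hm
  · left
    exact eq_of_mem hx hx'

/-- Cells are ordered by `σ ≤ τ` iff the open cell `σ` lies in the closure of the open
cell `τ`. -/
instance [T2Space X] : PartialOrder (Cell C) where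
  le s t := s.openCell ⊆ closure t.openCell
  le_refl _ := subset_closure
  le_trans _ _ _ h₁ h₂ := h₁.trans (closure_minimal h₂ isClosed_closure)
  le_antisymm s t h₁ h₂ := by
    rcases eq_or_dim_lt h₁ with h | h
    · exact h
    · rcases eq_or_dim_lt h₂ with h' | h'
      · exact h'.symm
      · exact absurd (h.trans h') (lt_irrefl _)

/-- The points of the closed ball that the characteristic map of `e` sends into open cells of
dimension exactly `dim e - 1`. -/
def codimOnePreimage (e : Cell C) : Set (Fin e.dim → ℝ) :=
  {x ∈ closedBall 0 1 | ∃ s : Cell C, s.dim + 1 = e.dim ∧ e.charMap x ∈ s.openCell}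

/-- The characteristic map of `s` is an embedding of its closed ball into the closed ball of `e`,
followed by the characteristic map of `e`. -/
def FactorsThrough (s e : Cell C) : Prop :=
  ∃ ι : closedBall (0 : Fin s.dim → ℝ) 1 → closedBall (0 : Fin e.dim → ℝ) 1,
    IsEmbedding ι ∧ ∀ x, e.charMap (ι x) = s.charMap x

end Cell

/-- A CW complex is regular (with respect to its characteristic maps) if each characteristic map
restricts to a homeomorphism from the boundary of the ball onto a finite union of open cells of
lower dimension. -/
def IsRegular (C : Set X) [CWComplex C] : Prop :=
  ∀ e : Cell C, IsEmbedding ((sphere (0 : Fin e.dim → ℝ) 1).domRestrict e.charMap) ∧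
    ∃ S : Set (Cell C), S.Finite ∧ (∀ s ∈ S, s.dim < e.dim) ∧
      e.charMap '' sphere 0 1 = ⋃ s ∈ S, s.openCell

/-- The closure poset: the cells, with a least element adjoined. -/
abbrev ClosurePoset (C : Set X) [CWComplex C] := WithBot (Cell C)

/-- The rank in the closure poset: `0` for the adjoined least element and `dim e + 1` for a
cell `e`. -/
def closureRank {C : Set X} [CWComplex C] : ClosurePoset C → ℕ
  | none => 0
  | some e => e.dim + 1

/-- `rk` is the rank function of a (finite) graded poset with least element. -/
def IsRankFunction {P : Type*} [PartialOrder P] [OrderBot P] (rk : P → ℕ) : Prop :=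
  rk ⊥ = 0 ∧ ∀ u v : P, u ⋖ v → rk v = rk u + 1

/-- A finite graded poset, with rank function `rk`, is thin if each closed interval of rank two
has exactly four elements. -/
def IsThin {P : Type*} [PartialOrder P] [OrderBot P] (rk : P → ℕ) : Prop :=
  IsRankFunction rk ∧ ∀ u v : P, u ≤ v → rk v = rk u + 2 → (Icc u v).ncard = 4

/-- The open interval `(u, v)` is connected: it is nonempty and any two of its elements are joined
by a finite sequence of elements of it in which consecutive ones are comparable. (This says that
the `1`-skeleton of the order complex of `(u, v)` is a connected graph.) -/
def IsConnectedInterval {P : Type*} [PartialOrder P] (u v : P) : Prop :=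
  (SimpleGraph.fromRel fun a b : Ioo u v => a < b).Connected

end FiniteCW

/-!
Write `n` for the dimension of a cell `e`, and `f` for its characteristic map. Balls are those of
the maximum norm, that is, cubes. Both directions rest on invariance of domain, applied to the
boundary sphere of the ball of `e`, which has dimension `n - 1`.

*From the conditions to regularity.* It suffices that each `f` is injective on the sphere
(`isRegular_of_injOn`), which is shown by induction on `n` in `injOn_charMap_of_conditions`. The
lifts provided by the fifth condition embed the balls of the facets of `e` (its cells of
codimension one) into the sphere, and by the second and fourth conditions these lifts cover the
sphere (`Cell.exists_facet_lift`). So every preimage of a point `p` of a boundary cell `s` is the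
lift of `p` from some facet above `s`. For facets `s` the fourth condition applies directly. If
`s` has codimension at least three, induction on the codimension shows that lifts of `p` from
comparable cells strictly between `s` and `e` agree (`Cell.IsLift.eq_of_le`), and the
connectedness of this interval gives a single preimage. If `s` has codimension two, thinness
leaves two facets; if the lifts of `p` from them differed, the sphere would near one of them
coincide with a single embedded ball having this point on its boundary, contrary to invariance of
domain (`Cell.IsLift.eq_of_facets`).

*From regularity to the conditions.* Now `f` embeds the sphere, which is thereby decomposed into
cells. By invariance of dimension the facets are dense
(`Cell.sphere_subset_closure_codimOnePreimage`), and so the closure poset is graded. Near a point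
of a cell `s` of codimension two the sphere is made of half balls, one for each facet above `s`.
One half ball is not a neighbourhood (`Cell.exists_facet_ne`), while two already cover a
neighbourhood by `image_union_image_mem_nhdsWithin`, so a third cannot occur
(`Cell.facet_eq_or_eq`). If `s` has codimension at least three, removing it does not disconnect
small neighbourhoods of its points (`exists_isPreconnected_diff_of_sphere`), and a splitting of
the open interval above `s` would be such a disconnection (`Cell.of_compat_Ioo`).

The topology comes from one fact: a bounded continuous perturbation of the identity of `ℝⁿ` has a
zero (`exists_add_eq_zero`), a form of Brouwer's theorem that follows from the no-retraction
theorem by the volume argument of Milnor and Rogers. It yields the Poincaré–Miranda theorem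
(`exists_eq_zero_of_sign_on_faces`), hence invariance of domain (`image_mem_nhds_of_injOn`) and
the fact that a closed set which embeds in `ℝᵏ` with `k ≤ m - 2` does not separate a convex open
subset of `ℝᵐ` (`isPreconnected_diff_of_injOn`). For the latter, on such a set the `m - 1`
coordinates across a thin box can be perturbed to a map without zeros, as smooth maps do not raise
dimension.
-/

/-! ### No-retraction theorem and bounded perturbations of the identity -/

namespace FiniteCW

section NoRetraction

open MeasureTheory

/-- A polynomial of bounded degree is determined by its values at enough nodes, with universal
coefficients; here this is applied to `t ↦ det (1 + t A)`. -/
theorem exists_det_one_add_smul_eq_sum (E : Type*) [NormedAddCommGroup E] [NormedSpace ℝ E]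
    [FiniteDimensional ℝ E] {δ : ℝ} (hδ : 0 < δ) :
    ∃ (w v : Fin (Module.finrank ℝ E + 1) → ℝ), (∀ i, v i ∈ Ioo 0 δ) ∧ ∑ i, w i = 1 ∧
      ∀ A : E →L[ℝ] E, (1 + A).det = ∑ i, w i * (1 + v i • A).det := by
  classical
  set n := Module.finrank ℝ E
  let v : Fin (n + 1) → ℝ := fun i => δ * ((i : ℝ) + 1) / (n + 2)
  have hv : ∀ i, v i ∈ Ioo 0 δ := by
    intro i
    have hi : (i : ℝ) + 1 < n + 2 := by
      have : ((i : ℕ) : ℝ) < (n + 1 : ℕ) := by exact_mod_cast i.2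
      push_cast at this
      linarith
    refine ⟨by positivity, ?_⟩
    rw [div_lt_iff₀ (by positivity)]
    exact mul_lt_mul_of_pos_left hi hδ
  have hinj : Set.InjOn v (Finset.univ : Finset (Fin (n + 1))) := by
    intro i _ j _ hij
    have h2 : (n : ℝ) + 2 ≠ 0 := by positivity
    simp only [v] at hij
    field_simp at hij
    apply Fin.ext
    have : (i : ℝ) = j := by linarith
    exact_mod_cast this
  let w : Fin (n + 1) → ℝ := fun i => (Lagrange.basis Finset.univ v i).eval 1
  refine ⟨w, v, hv, ?_, ?_⟩
  · rw [← Polynomial.eval_finsetSum, Lagrange.sum_basis hinj Finset.univ_nonempty]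
    simp
  · intro A
    let b := Module.finBasis ℝ E
    let M := LinearMap.toMatrix b b (A : _ →ₗ[ℝ] _)
    let p : Polynomial ℝ := Matrix.det
      ((Polynomial.X : Polynomial ℝ) • M.map Polynomial.C +
        (1 : Matrix (Fin n) (Fin n) ℝ).map Polynomial.C)
    have hp : ∀ t : ℝ, p.eval t = (1 + t • A).det := by
      intro t
      have h1 : (1 + t • A).det = (1 + t • M).det := by
        rw [ContinuousLinearMap.det, ← LinearMap.det_toMatrix b]
        congr 1
        simp only [ContinuousLinearMap.toLinearMap_add, ContinuousLinearMap.toLinearMap_smul,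
          map_add, map_smul, M]
        congr 1
        exact LinearMap.toMatrix_one b
      rw [h1, ← Polynomial.coe_evalRingHom, RingHom.map_det]
      congr 1
      ext i j
      by_cases hij : i = j
      · simp [hij]; ring
      · simp [hij]; ring
    have hdeg : p.degree < (Finset.univ : Finset (Fin (n + 1))).card := by
      have := Polynomial.natDegree_det_X_add_C_le M 1
      refine lt_of_le_of_lt Polynomial.degree_le_natDegree ?_
      simp only [Finset.card_univ, Fintype.card_fin] at *
      exact_mod_cast Nat.lt_succ_of_le this
    have h1 := congrArg (Polynomial.eval 1) (Lagrange.eq_interpolate hinj hdeg)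
    rw [Lagrange.interpolate_apply, Polynomial.eval_finsetSum, hp, one_smul] at h1
    rw [h1]
    refine Finset.sum_congr rfl fun i _ => ?_
    rw [Polynomial.eval_mul, Polynomial.eval_C, hp, mul_comm]

/-- A map which is Lipschitz on a closed ball and zero on its boundary stays Lipschitz when it is
extended by zero. -/
theorem lipschitzWith_indicator_closedBall {E : Type*} [NormedAddCommGroup E] [NormedSpace ℝ E]
    {u : E → E} {R : ℝ} {K : NNReal} (hu : LipschitzOnWith K u (closedBall 0 R))
    (h0 : ∀ x, ‖x‖ = R → u x = 0) : LipschitzWith K ((closedBall (0 : E) R).indicator u) := by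
  have key : ∀ x y : E, ‖x‖ ≤ R → R < ‖y‖ → ‖u x‖ ≤ K * ‖x - y‖ := by
    intro x y hx hy
    have hcont : ContinuousOn (fun t : ℝ => ‖AffineMap.lineMap x y t‖) (Icc 0 1) := by
      apply Continuous.continuousOn
      exact (AffineMap.lineMap_continuous).norm
    obtain ⟨t, ht, htR⟩ := intermediate_value_Icc zero_le_one hcont
      (show R ∈ Icc _ _ by simpa using ⟨hx, hy.le⟩)
    have hz := hu.norm_sub_le (x := x) (y := AffineMap.lineMap x y t) (by simpa using hx)
      (by simpa using le_of_eq htR)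
    rw [h0 _ htR, sub_zero] at hz
    refine hz.trans (mul_le_mul_of_nonneg_left ?_ K.2)
    rw [← dist_eq_norm, ← dist_eq_norm, dist_left_lineMap]
    rw [Real.norm_of_nonneg ht.1]
    exact mul_le_of_le_one_left dist_nonneg ht.2
  refine LipschitzWith.of_dist_le_mul fun x y => ?_
  rw [dist_eq_norm, dist_eq_norm]
  by_cases hx : ‖x‖ ≤ R <;> by_cases hy : ‖y‖ ≤ R
  · rw [indicator_of_mem (by simpa using hx), indicator_of_mem (by simpa using hy)]
    exact hu.norm_sub_le (by simpa using hx) (by simpa using hy)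
  · rw [indicator_of_mem (by simpa using hx), indicator_of_notMem (by simpa using hy), sub_zero]
    exact key x y hx (not_le.1 hy)
  · rw [indicator_of_notMem (by simpa using hx), indicator_of_mem (by simpa using hy), zero_sub,
      norm_neg, norm_sub_rev]
    exact key y x hy (not_le.1 hx)
  · rw [indicator_of_notMem (by simpa using hx), indicator_of_notMem (by simpa using hy)]
    simp only [sub_zero, norm_zero]
    positivity

/-- A Lipschitz perturbation of the identity with small constant that vanishes off the ball maps
the ball bijectively onto itself. -/
theorem image_ball_add_smul {E : Type*} [NormedAddCommGroup E] [NormedSpace ℝ E] [CompleteSpace E]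
    {u : E → E} {R : ℝ} {K : NNReal} (hu : LipschitzWith K u) (h0 : ∀ x, R ≤ ‖x‖ → u x = 0)
    {t : ℝ} (ht0 : 0 ≤ t) (ht : t * K < 1) :
    Function.Injective (fun x => x + t • u x) ∧ (fun x => x + t • u x) '' ball 0 R = ball 0 R := by
  set f : E → E := fun x => x + t • u x with hf
  have hA : ApproximatesLinearOn f ((ContinuousLinearEquiv.refl ℝ E : E ≃L[ℝ] E) : E →L[ℝ] E) univ
      (t.toNNReal * K) := by
    intro x _ y _
    have : f x - f y - (ContinuousLinearEquiv.refl ℝ E : E →L[ℝ] E) (x - y)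
        = t • (u x - u y) := by
      simp [hf, smul_sub]; abel
    rw [this, norm_smul, Real.norm_of_nonneg ht0]
    have := hu.norm_sub_le x y
    rw [NNReal.coe_mul, Real.coe_toNNReal t ht0, mul_assoc]
    exact mul_le_mul_of_nonneg_left this ht0
  have hc : Subsingleton E ∨ t.toNNReal * K <
      ‖((ContinuousLinearEquiv.refl ℝ E).symm : E →L[ℝ] E)‖₊⁻¹ := by
    rcases subsingleton_or_nontrivial E with h | h
    · exact Or.inl h
    · right
      have : ‖((ContinuousLinearEquiv.refl ℝ E).symm : E →L[ℝ] E)‖₊ = 1 := by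
        ext
        exact ContinuousLinearMap.norm_id
      rw [this, inv_one]
      rw [← NNReal.coe_lt_coe, NNReal.coe_mul, Real.coe_toNNReal t ht0]
      exact ht
  have hinj : Function.Injective f := injOn_univ.1 (hA.injOn hc)
  have hsurj := hA.surjective hc
  have hid : ∀ x, R ≤ ‖x‖ → f x = x := fun x hx => by simp [hf, h0 x hx]
  refine ⟨hinj, ?_⟩
  ext y
  simp only [mem_image, mem_ball_zero_iff]
  constructor
  · rintro ⟨x, hx, rfl⟩
    by_contra hcon
    have := hinj (hid (f x) (not_lt.1 hcon))
    rw [this] at hcon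
    exact hcon hx
  · intro hy
    obtain ⟨x, rfl⟩ := hsurj y
    refine ⟨x, ?_, rfl⟩
    by_contra hcon
    rw [hid x (not_lt.1 hcon)] at hy
    exact hcon hy

/-- There is no `C¹` map of Euclidean space into the sphere of radius `R` that fixes this sphere
pointwise. For small `t` the map `(1 - t) id + t r` is a diffeomorphism of the ball, so the integral
of its Jacobian determinant is the volume of the ball. This integral is polynomial in `t`, and at
`t = 1` it vanishes, as the derivative of `r` is everywhere singular. -/
theorem no_contDiff_retraction {E : Type*} [NormedAddCommGroup E] [InnerProductSpace ℝ E]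
    [FiniteDimensional ℝ E] {R : ℝ} (hR : 0 < R) (r : E → E) (hr : ContDiff ℝ 1 r)
    (hrR : ∀ x, ‖r x‖ = R) (hid : ∀ x, ‖x‖ = R → r x = x) : False := by
  let _ : MeasurableSpace E := borel E
  have _ : BorelSpace E := ⟨rfl⟩
  let A : E → E →L[ℝ] E := fun x => fderiv ℝ r x - 1
  have hAcont : Continuous A := (hr.continuous_fderiv one_ne_zero).sub continuous_const
  have hder : ∀ x, HasFDerivAt (fun x => r x - x) (A x) x := fun x =>
    ((hr.differentiable one_ne_zero x).hasFDerivAt).sub (hasFDerivAt_id x)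
  obtain ⟨K, hK⟩ : ∃ K : NNReal, ∀ x ∈ closedBall (0 : E) R, ‖A x‖₊ ≤ K := by
    obtain ⟨M, hM⟩ := (isCompact_closedBall (0 : E) R).exists_bound_of_continuousOn
      hAcont.continuousOn
    refine ⟨M.toNNReal, fun x hx => ?_⟩
    rw [← NNReal.coe_le_coe]
    exact (hM x hx).trans (Real.le_coe_toNNReal M)
  have hlipOn : LipschitzOnWith K (fun x => r x - x) (closedBall (0 : E) R) :=
    (convex_closedBall (0 : E) R).lipschitzOnWith_of_nnnorm_hasFDerivWithin_le
      (fun x _ => (hder x).hasFDerivWithinAt) hK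
  set u : E → E := (closedBall (0 : E) R).indicator fun x => r x - x with hu
  have hlip : LipschitzWith K u :=
    lipschitzWith_indicator_closedBall hlipOn fun x hx => by simp [hid x hx]
  have hu0 : ∀ x, R ≤ ‖x‖ → u x = 0 := by
    intro x hx
    rcases hx.eq_or_lt with h | h
    · rw [hu, indicator_of_mem (by simp [h]), hid x h.symm, sub_self]
    · rw [hu, indicator_of_notMem (by simpa using h)]
  have huder : ∀ x ∈ ball (0 : E) R, HasFDerivAt u (A x) x := by
    intro x hx
    refine (hder x).congr_of_eventuallyEq ?_
    filter_upwards [isOpen_ball.mem_nhds hx] with y hy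
    rw [hu, indicator_of_mem (ball_subset_closedBall hy)]
  -- Near the identity determinants are positive.
  obtain ⟨η, hη, hdet⟩ : ∃ η > 0, ∀ B : E →L[ℝ] E, ‖B‖ < η → 0 < (1 + B).det := by
    have hc : Continuous fun B : E →L[ℝ] E => (1 + B).det :=
      ContinuousLinearMap.continuous_det.comp (continuous_const.add continuous_id)
    have h1 : (0 : ℝ) < (1 + (0 : E →L[ℝ] E)).det := by
      rw [add_zero]
      have : (1 : E →L[ℝ] E).det = 1 := by simp [ContinuousLinearMap.det]
      rw [this]; exact one_pos
    obtain ⟨η, hη, h⟩ := Metric.eventually_nhds_iff.1 (hc.continuousAt.eventually_const_lt h1)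
    exact ⟨η, hη, fun B hB => h (by simpa using hB)⟩
  let δ : ℝ := min 1 η / (K + 1)
  have hK1 : (0 : ℝ) < K + 1 := by positivity
  have hδ : 0 < δ := div_pos (lt_min one_pos hη) hK1
  obtain ⟨w, v, hv, hw, hwv⟩ := exists_det_one_add_smul_eq_sum E hδ
  have hvK : ∀ i, v i * K < min 1 η := by
    intro i
    have h1 := (lt_div_iff₀ hK1).1 (hv i).2
    nlinarith [(hv i).1]
  -- The integral of the determinant at each node is the volume of the ball.
  have hvol : ∀ i, ∫ x in ball (0 : E) R, (1 + v i • A x).det = volume.real (ball (0 : E) R) := by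
    intro i
    obtain ⟨hinj, himg⟩ := image_ball_add_smul hlip hu0 (hv i).1.le
      ((hvK i).trans_le (min_le_left _ _))
    have hpos : ∀ x ∈ ball (0 : E) R, 0 < (1 + v i • A x).det := by
      intro x hx
      apply hdet
      rw [norm_smul, Real.norm_of_nonneg (hv i).1.le]
      refine lt_of_le_of_lt ?_ ((hvK i).trans_le (min_le_right _ _))
      exact mul_le_mul_of_nonneg_left (hK x (ball_subset_closedBall hx)) (hv i).1.le
    have h1 := integral_image_eq_integral_abs_det_fderiv_smul volume
      (measurableSet_ball (x := (0 : E)) (ε := R))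
      (f := fun x => x + v i • u x) (f' := fun x => 1 + v i • A x)
      (fun x hx => ((hasFDerivAt_id x).add ((huder x hx).const_smul (v i))).hasFDerivWithinAt)
      hinj.injOn (fun _ => (1 : ℝ))
    rw [himg] at h1
    simp only [smul_eq_mul, mul_one, integral_const, measureReal_restrict_apply_univ] at h1
    rw [h1]
    refine setIntegral_congr_fun measurableSet_ball fun x hx => ?_
    exact (abs_of_pos (hpos x hx)).symm
  have hint : ∀ i, IntegrableOn (fun x => w i * (1 + v i • A x).det) (ball (0 : E) R) := by
    intro i
    have hc : Continuous fun x => w i * (1 + v i • A x).det :=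
      continuous_const.mul (ContinuousLinearMap.continuous_det.comp
        (continuous_const.add (hAcont.const_smul (v i))))
    exact (hc.continuousOn.integrableOn_compact (isCompact_closedBall (0 : E) R)).mono_set
      ball_subset_closedBall
  have hsum : ∫ x in ball (0 : E) R, (1 + A x).det = volume.real (ball (0 : E) R) := by
    rw [funext fun x => hwv (A x), integral_finsetSum _ fun i _ => hint i]
    simp_rw [integral_const_mul, hvol]
    rw [← Finset.sum_mul, hw, one_mul]
  -- The derivative of `r` is singular, since its range is orthogonal to `r x`.
  have hzero : ∀ x, (1 + A x).det = 0 := by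
    intro x
    have hA1 : 1 + A x = fderiv ℝ r x := add_sub_cancel _ _
    rw [hA1]
    by_contra hne
    have hd := (hr.differentiable one_ne_zero x).hasFDerivAt
    have hns : HasFDerivAt (fun y => ‖r y‖ ^ 2) (2 • (innerSL ℝ (r x)).comp (fderiv ℝ r x)) x :=
      hd.norm_sq
    have hconst : HasFDerivAt (fun y => ‖r y‖ ^ 2) (0 : E →L[ℝ] ℝ) x := by
      simp_rw [hrR]
      exact hasFDerivAt_const _ _
    have heq := hns.unique hconst
    have hunit : IsUnit (LinearMap.det (fderiv ℝ r x : E →ₗ[ℝ] E)) := isUnit_iff_ne_zero.2 hne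
    obtain ⟨z, hz⟩ := (LinearMap.equivOfDetNeZero _ hne).surjective (r x)
    have hz' : fderiv ℝ r x z = r x := hz
    have := congrArg (fun L : E →L[ℝ] ℝ => L z) heq
    simp [hz', hrR x] at this
    exact hR.ne' this
  have h0 : volume.real (ball (0 : E) R) = 0 := by
    rw [← hsum]
    simp [hzero]
  have : 0 < volume.real (ball (0 : E) R) :=
    ENNReal.toReal_pos (measure_ball_pos volume _ hR).ne' measure_ball_lt_top.ne
  exact this.ne' h0

/-- A continuous self-map of Euclidean space that agrees with the identity off a ball has a zero. -/
theorem exists_eq_zero_of_eq_id_off_ball {E : Type*} [NormedAddCommGroup E] [InnerProductSpace ℝ E]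
    [FiniteDimensional ℝ E] {R : ℝ} (f : E → E) (hf : Continuous f)
    (hid : ∀ x, R < ‖x‖ → f x = x) : ∃ x, f x = 0 := by
  by_contra! hne
  set R' : ℝ := max R 0 + 1
  have hR' : 0 < R' := by positivity
  have hRR' : R < R' := by
    have := le_max_left R 0
    simp only [R']; linarith
  obtain ⟨h, hh, happ, heq, -⟩ := hf.exists_contDiff_approx_and_eqOn 1 (ε := fun x => ‖f x‖)
    hf.norm (fun x => norm_pos_iff.2 (hne x)) (S := {x | R' ≤ ‖x‖}) (U := {x | R < ‖x‖})
    (isClosed_le continuous_const continuous_norm)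
    ((isOpen_lt continuous_const continuous_norm).mem_nhdsSet.2 fun x hx => hRR'.trans_le hx)
    (contDiff_id.contDiffOn.congr fun x hx => hid x hx)
  have hh0 : ∀ x, h x ≠ 0 := by
    intro x hx
    have := happ x
    rw [hx, dist_zero_left] at this
    exact lt_irrefl _ this
  refine no_contDiff_retraction hR' (fun x => (R' * ‖h x‖⁻¹) • h x) ?_ ?_ ?_
  · have hh : ContDiff ℝ 1 h := hh
    exact (contDiff_const.mul ((hh.norm ℝ hh0).inv fun x => norm_ne_zero_iff.2 (hh0 x))).smul hh
  · intro x
    rw [norm_smul, norm_mul, norm_inv, norm_norm, mul_assoc,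
      inv_mul_cancel₀ (norm_ne_zero_iff.2 (hh0 x)), mul_one, Real.norm_of_nonneg hR'.le]
  · intro x hx
    have : h x = x := (heq hx.ge).trans (hid x (hx ▸ hRR'))
    rw [this, hx, mul_inv_cancel₀ hR'.ne', one_smul]

/-- A bounded continuous perturbation of the identity of a finite-dimensional space has a zero; this
is a form of Brouwer's fixed point theorem. -/
theorem exists_add_eq_zero {E : Type*} [NormedAddCommGroup E] [NormedSpace ℝ E]
    [FiniteDimensional ℝ E] {g : E → E} (hg : Continuous g) {M : ℝ} (hM : ∀ x, ‖g x‖ ≤ M) :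
    ∃ x, x + g x = 0 := by
  let L : E ≃L[ℝ] EuclideanSpace ℝ (Fin (Module.finrank ℝ E)) :=
    ContinuousLinearEquiv.ofFinrankEq (by simp)
  -- The perturbation is cut off at distance `M + 1`, beyond which it cannot create zeros.
  let χ : E → ℝ := fun x => max 0 (min 1 (M + 2 - ‖x‖))
  have hχ : Continuous χ := by fun_prop
  set N : ℝ := ‖(L : E →L[ℝ] EuclideanSpace ℝ (Fin (Module.finrank ℝ E)))‖
  have hN : ∀ x, ‖L x‖ ≤ N * ‖x‖ :=
    (L : E →L[ℝ] EuclideanSpace ℝ (Fin (Module.finrank ℝ E))).le_opNorm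
  obtain ⟨y, hy⟩ := exists_eq_zero_of_eq_id_off_ball (R := N * (M + 2))
    (fun y => L (L.symm y + χ (L.symm y) • g (L.symm y)))
    (L.continuous.comp (L.symm.continuous.add
      ((hχ.comp L.symm.continuous).smul (hg.comp L.symm.continuous)))) (by
      intro y hy
      have h1 : M + 2 < ‖L.symm y‖ := by
        by_contra hcon
        have h2 := hN (L.symm y)
        rw [L.apply_symm_apply] at h2
        exact hy.not_ge (h2.trans (mul_le_mul_of_nonneg_left (not_lt.1 hcon) (norm_nonneg _)))
      have h2 : χ (L.symm y) = 0 :=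
        max_eq_left ((min_le_right _ _).trans (by linarith))
      simp [h2])
  set x := L.symm y with hx
  have hx0 : x + χ x • g x = 0 := L.map_eq_zero_iff.1 hy
  have hχ1 : χ x ≤ 1 := max_le zero_le_one (min_le_left _ _)
  have hχ0 : 0 ≤ χ x := le_max_left _ _
  have hxM : ‖x‖ ≤ M := by
    rw [eq_neg_of_add_eq_zero_left hx0, norm_neg, norm_smul, Real.norm_of_nonneg hχ0]
    exact (mul_le_of_le_one_left (norm_nonneg _) hχ1).trans (hM x)
  have : χ x = 1 := by
    simp only [χ]
    rw [min_eq_left (by linarith), max_eq_right zero_le_one]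
  rw [this, one_smul] at hx0
  exact ⟨x, hx0⟩

end NoRetraction
end FiniteCW

/-! ### Invariance of domain and of dimension -/

namespace FiniteCW

section Dimension

/-- A continuous injective map on a compact set has a continuous inverse. -/
theorem exists_continuousOn_leftInverse {Y Z : Type*} [TopologicalSpace Y] [TopologicalSpace Z]
    [T2Space Z] [Nonempty Y] {K : Set Y} (hK : IsCompact K) {f : Y → Z} (hf : ContinuousOn f K)
    (hinj : InjOn f K) : ∃ g : Z → Y, ContinuousOn g (f '' K) ∧ ∀ x ∈ K, g (f x) = x := by
  refine ⟨Function.invFunOn f K, ?_, fun x hx => hinj.leftInvOn_invFunOn hx⟩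
  rw [continuousOn_iff_isClosed]
  intro s hs
  refine ⟨f '' (K ∩ s), ((hK.inter_right hs).image_of_continuousOn
    (hf.mono inter_subset_left)).isClosed, ?_⟩
  ext z
  constructor
  · rintro ⟨hz, x, hx, rfl⟩
    refine ⟨⟨x, ⟨hx, ?_⟩, rfl⟩, x, hx, rfl⟩
    rwa [mem_preimage, hinj.leftInvOn_invFunOn hx] at hz
  · rintro ⟨⟨x, ⟨hx, hxs⟩, rfl⟩, -⟩
    refine ⟨?_, x, hx, rfl⟩
    rwa [mem_preimage, hinj.leftInvOn_invFunOn hx]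

/-- The **Poincaré–Miranda theorem** on the cube `[-1, 1]ⁿ`. -/
theorem exists_eq_zero_of_sign_on_faces {ι : Type*} [Fintype ι] {f : (ι → ℝ) → ι → ℝ}
    (hf : ContinuousOn f (closedBall 0 1))
    (hneg : ∀ x ∈ closedBall (0 : ι → ℝ) 1, ∀ i, x i = -1 → f x i ≤ 0)
    (hpos : ∀ x ∈ closedBall (0 : ι → ℝ) 1, ∀ i, x i = 1 → 0 ≤ f x i) :
    ∃ x ∈ closedBall (0 : ι → ℝ) 1, f x = 0 := by
  -- `c` is the nearest point retraction onto the cube.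
  let c : (ι → ℝ) → ι → ℝ := fun x i => max (-1) (min 1 (x i))
  have hc : Continuous c := by fun_prop
  have hcmem : ∀ x, c x ∈ closedBall (0 : ι → ℝ) 1 := by
    intro x
    rw [mem_closedBall_zero_iff, pi_norm_le_iff_of_nonneg zero_le_one]
    intro i
    rw [Real.norm_eq_abs, abs_le]
    exact ⟨le_max_left _ _, max_le (by norm_num) (min_le_left _ _)⟩
  have hfc : Continuous fun x => f (c x) := hf.comp_continuous hc hcmem
  obtain ⟨M, hM⟩ := (isCompact_closedBall (0 : ι → ℝ) 1).exists_bound_of_continuousOn hf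
  obtain ⟨x, hx⟩ := exists_add_eq_zero (g := fun x => f (c x) - c x) (hfc.sub hc) (M := M + 1)
    fun x => (norm_sub_le _ _).trans (add_le_add (hM _ (hcmem x))
      (mem_closedBall_zero_iff.1 (hcmem x)))
  have hxi : ∀ i, x i + (f (c x) i - c x i) = 0 := fun i => congrFun hx i
  have hcx : c x = x := by
    ext i
    have h1 := hxi i
    rcases lt_or_ge (x i) (-1) with h | h
    · have h2 : c x i = -1 := by
        simp only [c]
        rw [min_eq_right (by linarith), max_eq_left h.le]
      have := hneg _ (hcmem x) i h2
      linarith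
    · rcases lt_or_ge 1 (x i) with h' | h'
      · have h2 : c x i = 1 := by
          simp only [c]
          rw [min_eq_left h'.le, max_eq_right (by norm_num)]
        have := hpos _ (hcmem x) i h2
        linarith
      · simp only [c]
        rw [min_eq_right h', max_eq_right h]
  refine ⟨x, hcx ▸ hcmem x, ?_⟩
  ext i
  have := hxi i
  rw [hcx] at this
  simpa using this

/-- A continuous map from the ball that moves points by at most the radius has a zero. -/
theorem exists_eq_zero_of_norm_sub_le {n : ℕ} {f : (Fin n → ℝ) → Fin n → ℝ}
    (hf : ContinuousOn f (closedBall 0 1)) (h : ∀ x ∈ closedBall (0 : Fin n → ℝ) 1, ‖f x - x‖ ≤ 1) :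
    ∃ x ∈ closedBall (0 : Fin n → ℝ) 1, f x = 0 := by
  refine exists_eq_zero_of_sign_on_faces hf ?_ ?_ <;>
  · intro x hx i hi
    have := (norm_le_pi_norm (f x - x) i).trans (h x hx)
    rw [Real.norm_eq_abs, abs_le, Pi.sub_apply, hi] at this
    linarith [this.1, this.2]

open MeasureTheory in
/-- Local form of the invariance of domain at the centre of the unit ball. Otherwise the extension
`G` of the inverse of `f` could be perturbed to a nonvanishing map on the image of `f`, contrary to
`exists_eq_zero_of_norm_sub_le`. -/
theorem image_closedBall_mem_nhds {n : ℕ} {f : (Fin n → ℝ) → Fin n → ℝ}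
    (hf : ContinuousOn f (closedBall 0 1)) (hinj : InjOn f (closedBall 0 1)) :
    f '' closedBall 0 1 ∈ 𝓝 (f 0) := by
  set B := closedBall (0 : Fin n → ℝ) 1
  set K := f '' B
  have hBc : IsCompact B := isCompact_closedBall _ _
  have hK : IsCompact K := hBc.image_of_continuousOn hf
  have h0B : (0 : Fin n → ℝ) ∈ B := by simp [B]
  obtain ⟨g, hg, hgf⟩ := exists_continuousOn_leftInverse hBc hf hinj
  obtain ⟨G, hG⟩ := ContinuousMap.exists_restrict_eq hK.isClosed
    ⟨K.domRestrict g, continuousOn_iff_continuous_domRestrict.1 hg⟩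
  have hGf : ∀ x ∈ B, G (f x) = x := by
    intro x hx
    have := congrArg (fun F : C(K, Fin n → ℝ) => F ⟨f x, x, hx, rfl⟩) hG
    exact this.trans (hgf x hx)
  by_contra hnot
  obtain ⟨δ, hδ, hδG⟩ := Metric.continuousAt_iff.1 (G.continuous.continuousAt (x := f 0))
    (1 / 10) (by norm_num)
  rw [hGf 0 h0B] at hδG
  simp only [dist_zero_right] at hδG
  obtain ⟨c, hc, hcK⟩ : ∃ c ∈ ball (f 0) (δ / 3), c ∉ K := by
    by_contra! hcon
    exact hnot (Filter.mem_of_superset (ball_mem_nhds _ (by positivity)) hcon)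
  have hδ3 : 0 < δ / 3 := by positivity
  -- On `K` away from `c`, the map `G` is bounded away from zero.
  obtain ⟨η, hη, hη1, hηG⟩ : ∃ η : ℝ, 0 < η ∧ η ≤ 1 / 10 ∧
      ∀ y ∈ K, δ / 3 ≤ dist y c → η ≤ ‖G y‖ := by
    have hS : IsCompact (K ∩ {y | δ / 3 ≤ dist y c}) :=
      hK.inter_right (isClosed_le continuous_const (continuous_id.dist continuous_const))
    rcases (K ∩ {y | δ / 3 ≤ dist y c}).eq_empty_or_nonempty with he | hne
    · exact ⟨1 / 10, by norm_num, le_rfl, fun y hy hyc => absurd (he ▸ ⟨hy, hyc⟩ : y ∈ (∅ : Set _))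
        (notMem_empty y)⟩
    · obtain ⟨y₀, ⟨⟨x₀, hx₀, rfl⟩, hy₀⟩, hmin⟩ :=
        hS.exists_isMinOn hne G.continuous.norm.continuousOn
      refine ⟨min (1 / 10) ‖G (f x₀)‖, lt_min (by norm_num) ?_, min_le_left _ _,
        fun y hy hyc => (min_le_right _ _).trans (hmin ⟨hy, hyc⟩)⟩
      rw [hGf _ hx₀, norm_pos_iff]
      rintro rfl
      exact (mem_ball'.1 hc).not_ge hy₀
  obtain ⟨P, hP, hPG, -⟩ := G.continuous.exists_contDiff_approx 1 (ε := fun _ => η / 2)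
    continuous_const (fun _ => by positivity)
  have hP : ContDiff ℝ 1 P := hP
  -- The image of the sphere under `P` is a null set, so a small translation moves it off zero.
  obtain ⟨v, hv, hvP⟩ : ∃ v ∈ ball (0 : Fin n → ℝ) (η / 2), v ∉ P '' sphere c (δ / 3) := by
    by_contra! hcon
    have hnull : volume (P '' sphere c (δ / 3)) = 0 :=
      addHaar_image_eq_zero_of_differentiableOn_of_addHaar_eq_zero volume
        (hP.differentiable one_ne_zero).differentiableOn
        (Measure.addHaar_sphere_of_ne_zero volume c hδ3.ne')
    exact (measure_ball_pos volume (0 : Fin n → ℝ) (by positivity : 0 < η / 2)).ne'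
      (measure_mono_null hcon hnull)
  -- `Φ` pushes the part of `K` near `c` radially onto the sphere around `c`.
  let Φ : (Fin n → ℝ) → Fin n → ℝ := fun y => c + max (δ / 3 * ‖y - c‖⁻¹) 1 • (y - c)
  have hΦ : ContinuousOn Φ K := by
    have hne : ∀ y ∈ K, ‖y - c‖ ≠ 0 := by
      rintro y hy h
      rw [norm_eq_zero, sub_eq_zero] at h
      exact hcK (h ▸ hy)
    have h1 : ContinuousOn (fun y => ‖y - c‖⁻¹) K :=
      ContinuousOn.inv₀ (by fun_prop) hne
    have h2 : ContinuousOn (fun y => max (δ / 3 * ‖y - c‖⁻¹) 1) K :=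
      (continuousOn_const.mul h1).sup continuousOn_const
    exact continuousOn_const.add (h2.smul (by fun_prop))
  have hΦfar : ∀ y ∈ K, δ / 3 ≤ dist y c → Φ y = y := by
    intro y _ hyc
    have : max (δ / 3 * ‖y - c‖⁻¹) 1 = 1 := by
      apply max_eq_right
      rw [dist_eq_norm] at hyc
      rw [← div_eq_mul_inv]
      exact div_le_one_of_le₀ hyc (norm_nonneg _)
    simp only [Φ, this, one_smul, add_sub_cancel]
  have hΦnear : ∀ y ∈ K, dist y c < δ / 3 → Φ y ∈ sphere c (δ / 3) := by
    intro y hy hyc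
    have hpos : 0 < ‖y - c‖ := by
      rw [norm_pos_iff, sub_ne_zero]
      rintro rfl
      exact hcK hy
    have : max (δ / 3 * ‖y - c‖⁻¹) 1 = δ / 3 * ‖y - c‖⁻¹ := by
      apply max_eq_left
      rw [dist_eq_norm] at hyc
      rw [← div_eq_mul_inv, one_le_div hpos]
      exact hyc.le
    rw [mem_sphere, dist_eq_norm]
    simp only [Φ, this, add_sub_cancel_left]
    rw [norm_smul, norm_mul, norm_inv, norm_norm, mul_assoc, inv_mul_cancel₀ hpos.ne', mul_one,
      Real.norm_of_nonneg hδ3.le]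
  have hPG' : ∀ y, ‖P y - v - G y‖ < η := by
    intro y
    have h1 := hPG y
    rw [dist_eq_norm] at h1
    rw [mem_ball_zero_iff] at hv
    calc ‖P y - v - G y‖ = ‖(P y - G y) - v‖ := by congr 1; abel
      _ ≤ ‖P y - G y‖ + ‖v‖ := norm_sub_le _ _
      _ < η := by linarith
  obtain ⟨x, hx, hx0⟩ := exists_eq_zero_of_norm_sub_le (f := fun x => P (Φ (f x)) - v)
    ((hP.continuous.comp_continuousOn (hΦ.comp hf (mapsTo_image f B))).sub continuousOn_const) (by
      intro x hx
      rcases le_or_gt (δ / 3) (dist (f x) c) with h | h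
      · rw [hΦfar _ ⟨x, hx, rfl⟩ h]
        have := hPG' (f x)
        rw [hGf x hx] at this
        linarith
      · have h1 := hΦnear _ ⟨x, hx, rfl⟩ h
        have h2 : ‖G (Φ (f x))‖ < 1 / 10 := by
          apply hδG
          have := dist_triangle (Φ (f x)) c (f 0)
          rw [mem_sphere.1 h1] at this
          have := mem_ball.1 hc
          linarith
        have h3 : ‖G (f x)‖ < 1 / 10 := by
          apply hδG
          have := dist_triangle (f x) c (f 0)
          have := mem_ball.1 hc
          linarith
        rw [hGf x hx] at h3
        calc ‖P (Φ (f x)) - v - x‖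
            = ‖(P (Φ (f x)) - v - G (Φ (f x))) + G (Φ (f x)) - x‖ := by congr 1; abel
          _ ≤ ‖(P (Φ (f x)) - v - G (Φ (f x)))‖ + ‖G (Φ (f x))‖ + ‖x‖ :=
            (norm_sub_le _ _).trans (add_le_add (norm_add_le _ _) le_rfl)
          _ ≤ 1 := by linarith [hPG' (Φ (f x))])
  rcases le_or_gt (δ / 3) (dist (f x) c) with h | h
  · have h1 := hηG _ ⟨x, hx, rfl⟩ h
    have h2 := hPG' (f x)
    have h3 : P (f x) - v = 0 := by
      have := hx0
      simp only [hΦfar _ ⟨x, hx, rfl⟩ h] at this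
      exact this
    rw [h3, zero_sub, norm_neg] at h2
    exact h2.not_ge h1
  · exact hvP ⟨_, hΦnear _ ⟨x, hx, rfl⟩ h, sub_eq_zero.1 hx0⟩

/-- **Invariance of domain**. -/
theorem image_mem_nhds_of_injOn {n : ℕ} {f : (Fin n → ℝ) → Fin n → ℝ} {U : Set (Fin n → ℝ)}
    {x : Fin n → ℝ} (hU : U ∈ 𝓝 x) (hf : ContinuousOn f U) (hinj : InjOn f U) :
    f '' U ∈ 𝓝 (f x) := by
  obtain ⟨r, hr, hrU⟩ := Metric.nhds_basis_closedBall.mem_iff.1 hU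
  have hmaps : MapsTo (fun z : Fin n → ℝ => x + r • z) (closedBall 0 1) U := by
    intro z hz
    apply hrU
    rw [mem_closedBall_zero_iff] at hz
    rw [mem_closedBall, dist_eq_norm, add_sub_cancel_left, norm_smul, Real.norm_of_nonneg hr.le]
    exact mul_le_of_le_one_right hr.le hz
  have h := image_closedBall_mem_nhds (f := fun z => f (x + r • z))
    (hf.comp (by fun_prop) hmaps) (by
      intro z hz w hw hzw
      have := hinj (hmaps hz) (hmaps hw) hzw
      exact smul_right_injective _ hr.ne' (add_left_cancel this))
  simp only [smul_zero, add_zero] at h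
  refine Filter.mem_of_superset h ?_
  rintro _ ⟨z, hz, rfl⟩
  exact ⟨_, hmaps hz, rfl⟩

/-- **Invariance of dimension**: a nonempty open subset of `ℝᵐ` does not embed in `ℝᵏ` if
`k < m`. -/
theorem not_injOn_of_lt {m k : ℕ} (hkm : k < m) {f : (Fin m → ℝ) → Fin k → ℝ}
    {U : Set (Fin m → ℝ)} {x : Fin m → ℝ} (hU : U ∈ 𝓝 x) (hf : ContinuousOn f U) :
    ¬ InjOn f U := by
  intro hinj
  let L : (Fin k → ℝ) → Fin m → ℝ := fun v j => if h : (j : ℕ) < k then v ⟨j, h⟩ else 0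
  have hL : Continuous L := by
    refine continuous_pi fun j => ?_
    by_cases h : (j : ℕ) < k
    · simp only [L, h, dif_pos]; fun_prop
    · simp only [L, h, dif_neg, not_false_eq_true]; fun_prop
  have hLinj : Function.Injective L := by
    intro v w hvw
    ext i
    have := congrFun hvw ⟨i, i.2.trans hkm⟩
    simpa [L] using this
  have h := image_mem_nhds_of_injOn hU (hL.comp_continuousOn hf) (hLinj.comp_injOn hinj)
  -- The image lies in a coordinate hyperplane, which has empty interior.
  have ht : Filter.Tendsto (fun t : ℝ => Function.update (L (f x)) ⟨k, hkm⟩ t) (𝓝 0)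
      (𝓝 (L (f x))) := by
    have hc : Continuous fun t : ℝ => Function.update (L (f x)) ⟨k, hkm⟩ t := by fun_prop
    have h0 : Function.update (L (f x)) ⟨k, hkm⟩ 0 = L (f x) := by
      have : (0 : ℝ) = L (f x) ⟨k, hkm⟩ := by simp [L]
      rw [this, Function.update_eq_self]
    simpa [h0] using hc.tendsto 0
  obtain ⟨ε, hε, hε'⟩ := Metric.eventually_nhds_iff.1 (ht.eventually h)
  obtain ⟨z, -, hz⟩ := hε' (y := ε / 2) (by simp [abs_of_pos hε, hε])
  have := congrFun hz ⟨k, hkm⟩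
  simp [L] at this
  linarith

end Dimension
end FiniteCW

/-! ### Separation by sets of small dimension, and the boundary of the cube -/

namespace FiniteCW

section Separation

/-- Let `K` be a compact subset of `ℝᵐ` that embeds in a space `ℝᵏ` of dimension at most `m - 2`.
Then the identity map has a bounded perturbation whose coordinates other than `i` have no common
zero on `K`: transported to `ℝᵏ`, these `m - 1` coordinates are approximated by a smooth map,
whose range has dense complement. -/
theorem exists_perturbation_ne_zero {m k : ℕ} (hk : k + 2 ≤ m) (i : Fin m) {K : Set (Fin m → ℝ)}
    (hK : IsCompact K) {γ : (Fin m → ℝ) → Fin k → ℝ} (hγ : ContinuousOn γ K) (hinj : InjOn γ K) :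
    ∃ h : (Fin m → ℝ) → Fin m → ℝ, Continuous h ∧ (∀ q j, |h q j - q j| ≤ 1) ∧
      ∀ q ∈ K, ∃ j, j ≠ i ∧ h q j ≠ 0 := by
  classical
  have : Nonempty (Fin m → ℝ) := ⟨0⟩
  obtain ⟨g, hg, hgγ⟩ := exists_continuousOn_leftInverse hK hγ hinj
  -- The coordinates other than `i`, as functions on the compact set `γ '' K`, extended to `ℝᵏ`.
  obtain ⟨G, hG⟩ := ContinuousMap.exists_restrict_eq (hK.image_of_continuousOn hγ).isClosed
    ⟨(γ '' K).domRestrict g, continuousOn_iff_continuous_domRestrict.1 hg⟩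
  have hGγ : ∀ q ∈ K, G (γ q) = q := by
    intro q hq
    have := congrArg (fun F : C(γ '' K, Fin m → ℝ) => F ⟨γ q, q, hq, rfl⟩) hG
    exact this.trans (hgγ q hq)
  let ρ : (Fin k → ℝ) → {j // j ≠ i} → ℝ := fun v j => G v j
  have hρ : Continuous ρ := by fun_prop
  obtain ⟨P, hP, hPρ, -⟩ := hρ.exists_contDiff_approx 1 (ε := fun _ => 1 / 2)
    continuous_const (fun _ => by norm_num)
  have hP : ContDiff ℝ 1 P := hP
  have hrank : Module.finrank ℝ (Fin k → ℝ) < Module.finrank ℝ ({j // j ≠ i} → ℝ) := by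
    simp only [Module.finrank_fintype_fun_eq_card, Fintype.card_fin, ne_eq,
      Fintype.card_subtype_compl, Fintype.card_subtype_eq]
    omega
  obtain ⟨v, hvP, hv⟩ := (hP.dense_compl_range_of_finrank_lt_finrank hrank).inter_open_nonempty
    (ball 0 (1 / 2)) isOpen_ball ⟨0, by simp⟩
  have hcoord : ∀ j : {j // j ≠ i}, ∃ h : (Fin m → ℝ) → ℝ, Continuous h ∧
      (∀ q, |h q - q j| ≤ 1) ∧ ∀ q ∈ K, h q = P (γ q) j - v j := by
    intro j
    have hc : ContinuousOn (fun q : Fin m → ℝ => P (γ q) j - v j - q j) K := by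
      have h1 : ContinuousOn (fun q => P (γ q)) K := hP.continuous.comp_continuousOn hγ
      have h2 : ContinuousOn (fun q => P (γ q) j) K := continuousOn_pi.1 h1 j
      exact (h2.sub continuousOn_const).sub (by fun_prop)
    obtain ⟨H, hH, hHr⟩ := ContinuousMap.exists_restrict_eq_forall_mem_of_closed
      (s := K) ⟨_, continuousOn_iff_continuous_domRestrict.1 hc⟩ (t := Icc (-1) 1) (by
        rintro ⟨q, hq⟩
        have h1 := (norm_le_pi_norm (P (γ q) - ρ (γ q)) j).trans_lt
          ((dist_eq_norm _ _).symm.trans_lt (hPρ (γ q)))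
        have h2 := (norm_le_pi_norm v j).trans_lt (mem_ball_zero_iff.1 hvP)
        simp only [Pi.sub_apply, ρ, hGγ q hq, Real.norm_eq_abs, abs_lt] at h1 h2
        change P (γ q) j - v j - q j ∈ _
        constructor <;> linarith [h1.1, h1.2, h2.1, h2.2]) ⟨0, by norm_num⟩ hK.isClosed
    refine ⟨fun q => H q + q j, by fun_prop, fun q => ?_, fun q hq => ?_⟩
    · rw [add_sub_cancel_right, abs_le]
      exact hH q
    · have : H q = P (γ q) j - v j - q j := congrArg (fun F : C(K, ℝ) => F ⟨q, hq⟩) hHr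
      change H q + q j = _
      rw [this, sub_add_cancel]
  choose h hhc hh1 hhK using hcoord
  refine ⟨fun q j => if hj : j ≠ i then h ⟨j, hj⟩ q else q j, ?_, ?_, ?_⟩
  · refine continuous_pi fun j => ?_
    by_cases hj : j ≠ i
    · simp only [hj, dif_pos, not_false_eq_true, ne_eq]
      exact hhc _
    · simp only [hj, dif_neg, not_false_eq_true]
      fun_prop
  · intro q j
    by_cases hj : j ≠ i
    · simp only [hj, dif_pos, not_false_eq_true, ne_eq]
      exact hh1 ⟨j, hj⟩ q
    · simp [hj]
  · intro q hq
    by_contra! hcon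
    refine hv ⟨γ q, ?_⟩
    ext j
    have := hcon j j.2
    simp only [j.2, dif_pos, not_false_eq_true, ne_eq] at this
    rw [hhK j q hq] at this
    exact sub_eq_zero.1 this

/-- A closed subset of an open convex subset of `ℝᵐ` that embeds in a space of dimension at most
`m - 2` does not separate it. If it did, it would separate two opposite faces of a thin box, and
`exists_perturbation_ne_zero` would contradict the Poincaré–Miranda theorem on this box. -/
theorem isPreconnected_diff_of_injOn {m k : ℕ} (hk : k + 2 ≤ m) {U F : Set (Fin m → ℝ)}
    (hU : IsOpen U) (hUc : Convex ℝ U) (hF : IsClosed F) {g : (Fin m → ℝ) → Fin k → ℝ}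
    (hg : ContinuousOn g (U ∩ F)) (hinj : InjOn g (U ∩ F)) : IsPreconnected (U \ F) := by
  classical
  rintro u v hu hv hcover ⟨a, haU, hau⟩ ⟨b, hbU, hbv⟩
  by_contra hempty
  have hUF : IsOpen (U \ F) := hU.sdiff hF
  set A := (U \ F) ∩ u
  set B := (U \ F) ∩ v
  have hA : IsOpen A := hUF.inter hu
  have hB : IsOpen B := hUF.inter hv
  have hAB : ∀ w, w ∈ A → w ∉ B := fun w hwA hwB => hempty ⟨w, hwA.1, hwA.2, hwB.2⟩
  have haA : a ∈ A := ⟨haU, hau⟩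
  have hbB : b ∈ B := ⟨hbU, hbv⟩
  -- A continuous function that is positive on `A`, negative on `B`, and zero elsewhere.
  let φ : (Fin m → ℝ) → ℝ := fun w => infDist w Aᶜ - infDist w Bᶜ
  have hφ : Continuous φ := (continuous_infDist_pt _).sub (continuous_infDist_pt _)
  have hφA : ∀ w ∈ A, 0 < φ w := by
    intro w hw
    have h1 : 0 < infDist w Aᶜ := (hA.isClosed_compl.notMem_iff_infDist_pos
      ⟨b, fun h => hAB b h hbB⟩).1 (not_not.2 hw)
    have h2 : infDist w Bᶜ = 0 := infDist_zero_of_mem (hAB w hw)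
    simp only [φ]; linarith
  have hφB : ∀ w ∈ B, φ w < 0 := by
    intro w hw
    have h1 : 0 < infDist w Bᶜ := (hB.isClosed_compl.notMem_iff_infDist_pos
      ⟨a, hAB a haA⟩).1 (not_not.2 hw)
    have h2 : infDist w Aᶜ = 0 := infDist_zero_of_mem fun h => hAB w h hw
    simp only [φ]; linarith
  obtain ⟨i, hi⟩ : ∃ i, a i ≠ b i := by
    by_contra! hcon
    exact hAB a haA ((funext hcon : a = b) ▸ hbB)
  -- The box: coordinate `i` runs from `a` to `b`, the other coordinates span a thin cross section.
  let ψ : ℝ → (Fin m → ℝ) → Fin m → ℝ := fun δ q j =>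
    ((1 - q i) / 2 * a j + (1 + q i) / 2 * b j) + δ * (if j = i then 0 else q j)
  have hψ : Continuous fun p : ℝ × (Fin m → ℝ) => ψ p.1 p.2 := by
    refine continuous_pi fun j => ?_
    by_cases hj : j = i
    · simp only [ψ, hj, if_true]; fun_prop
    · simp only [ψ, hj, if_false]; fun_prop
  set Q := closedBall (0 : Fin m → ℝ) 1
  have hQi : ∀ q ∈ Q, ∀ j, q j ∈ Icc (-1) 1 := by
    intro q hq j
    have := (norm_le_pi_norm q j).trans (mem_closedBall_zero_iff.1 hq)
    rwa [Real.norm_eq_abs, abs_le] at this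
  have htube : ∀ C O : Set (Fin m → ℝ), IsCompact C → IsOpen O → (∀ q ∈ C, ψ 0 q ∈ O) →
      ∀ᶠ δ in 𝓝 (0 : ℝ), ∀ q ∈ C, ψ δ q ∈ O := by
    intro C O hC hO hCO
    refine hC.eventually_forall_of_forall_eventually fun q hq => ?_
    exact (hψ.continuousAt (x := (0, q))).eventually (hO.mem_nhds (hCO q hq))
  have hQc : IsCompact Q := isCompact_closedBall _ _
  have h1 := htube Q U hQc hU (by
    intro q hq
    have h := hQi q hq i
    have : ψ 0 q = ((1 - q i) / 2) • a + ((1 + q i) / 2) • b := by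
      ext j; simp [ψ]
    rw [this]
    exact hUc haU.1 hbU.1 (by linarith [h.2]) (by linarith [h.1]) (by ring))
  have h2 := htube (Q ∩ {q | q i = -1}) A
    (hQc.inter_right (isClosed_eq (continuous_apply i) continuous_const)) hA (by
      rintro q ⟨-, hq⟩
      have : ψ 0 q = a := by
        ext j; simp [ψ, show q i = -1 from hq]
      rwa [this])
  have h3 := htube (Q ∩ {q | q i = 1}) B
    (hQc.inter_right (isClosed_eq (continuous_apply i) continuous_const)) hB (by
      rintro q ⟨-, hq⟩
      have : ψ 0 q = b := by
        ext j; simp [ψ, show q i = 1 from hq]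
      rwa [this])
  obtain ⟨δ, ⟨hδU, hδA, hδB⟩, hδ⟩ :=
    (((h1.and (h2.and h3)).filter_mono nhdsWithin_le_nhds).and
      (self_mem_nhdsWithin (a := (0 : ℝ)) (s := Ioi 0))).exists
  have hδ : 0 < δ := hδ
  have hψδ : Continuous (ψ δ) := hψ.comp (by fun_prop : Continuous fun q => (δ, q))
  have hψinj : Function.Injective (ψ δ) := by
    intro q q' hqq
    have e1 : q i = q' i := by
      have := congrFun hqq i
      simp only [ψ, if_true] at this
      have h0 : (q i - q' i) * (b i - a i) = 0 := by linarith
      rcases mul_eq_zero.1 h0 with h | h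
      · linarith
      · exact absurd (by linarith) hi
    ext j
    by_cases hj : j = i
    · rw [hj, e1]
    · have := congrFun hqq j
      simp only [ψ, hj, if_false, e1] at this
      exact mul_left_cancel₀ hδ.ne' (by linarith)
  have hmaps : MapsTo (ψ δ) (Q ∩ ψ δ ⁻¹' F) (U ∩ F) := fun q hq => ⟨hδU q hq.1, hq.2⟩
  obtain ⟨h, hhc, hh1, hhK⟩ := exists_perturbation_ne_zero hk i
    (hQc.inter_right (hF.preimage hψδ)) (hg.comp hψδ.continuousOn hmaps)
    (hinj.comp hψinj.injOn hmaps)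
  obtain ⟨q, hq, hq0⟩ := exists_eq_zero_of_sign_on_faces
    (f := fun q j => if j = i then -φ (ψ δ q) else h q j) (by
      refine Continuous.continuousOn (continuous_pi fun j => ?_)
      by_cases hj : j = i
      · simp only [hj, if_true]; exact (hφ.comp hψδ).neg
      · simp only [hj, if_false]; exact (continuous_apply j).comp hhc) (by
      intro q hq j hqj
      by_cases hj : j = i
      · subst hj
        simp only [if_true]
        linarith [hφA _ (hδA q ⟨hq, hqj⟩)]
      · simp only [hj, if_false]
        have := abs_le.1 (hh1 q j)
        linarith [this.2]) (by
      intro q hq j hqj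
      by_cases hj : j = i
      · subst hj
        simp only [if_true]
        linarith [hφB _ (hδB q ⟨hq, hqj⟩)]
      · simp only [hj, if_false]
        have := abs_le.1 (hh1 q j)
        linarith [this.1])
  have hφ0 : φ (ψ δ q) = 0 := by
    have := congrFun hq0 i
    simpa using this
  have hFq : ψ δ q ∈ F := by
    by_contra hnF
    have hUFq : ψ δ q ∈ U \ F := ⟨hδU q hq, hnF⟩
    rcases hcover hUFq with h' | h'
    · exact (hφA _ ⟨hUFq, h'⟩).ne' hφ0
    · exact (hφB _ ⟨hUFq, h'⟩).ne hφ0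
  obtain ⟨j, hj, hj0⟩ := hhK q ⟨hq, hFq⟩
  have := congrFun hq0 j
  simp only [hj, if_false] at this
  exact hj0 this

end Separation

section Sphere

/-- Central projection from the origin gives a chart of the boundary of the cube around any of its
points: `φ` parametrizes the open half `N` of the boundary containing `x` by the whole of `ℝᵐ`. -/
theorem exists_sphere_chart {m : ℕ} {x : Fin (m + 1) → ℝ} (hx : ‖x‖ = 1) :
    ∃ (N : Set (Fin (m + 1) → ℝ)) (φ : (Fin m → ℝ) → Fin (m + 1) → ℝ)
      (χ : (Fin (m + 1) → ℝ) → Fin m → ℝ), IsOpen N ∧ x ∈ N ∧ Continuous φ ∧ ContinuousOn χ N ∧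
      (∀ z, ‖φ z‖ = 1 ∧ φ z ∈ N ∧ χ (φ z) = z) ∧ ∀ y ∈ N, ‖y‖ = 1 → φ (χ y) = y := by
  obtain ⟨i, hi⟩ : ∃ i, x i ≠ 0 := by
    by_contra! hcon
    rw [(funext hcon : x = 0), norm_zero] at hx
    exact zero_ne_one hx
  let w : (Fin m → ℝ) → Fin (m + 1) → ℝ := fun z => i.insertNth (x i) z
  have hwi : ∀ z, w z i = x i := fun z => by simp [w]
  have hwj : ∀ z j, w z (i.succAbove j) = z j := fun z j => by simp [w]
  have hw : Continuous w := by
    refine continuous_pi fun j => ?_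
    rcases Fin.eq_self_or_eq_succAbove i j with rfl | ⟨j, rfl⟩
    · simp only [hwi]; fun_prop
    · simp only [hwj]; fun_prop
  have hw0 : ∀ z, ‖w z‖ ≠ 0 := by
    intro z h
    rw [norm_eq_zero] at h
    exact hi ((hwi z).symm.trans (by rw [h]; rfl))
  refine ⟨{y | 0 < x i * y i}, fun z => ‖w z‖⁻¹ • w z, fun y j => x i / y i * y (i.succAbove j),
    isOpen_lt continuous_const (by fun_prop), mul_self_pos.2 hi,
    (hw.norm.inv₀ hw0).smul hw, ?_, ?_, ?_⟩
  · refine continuousOn_pi.2 fun j => ContinuousOn.mul (ContinuousOn.div (by fun_prop)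
      (by fun_prop) ?_) (by fun_prop)
    intro y hy h0
    rw [mem_ofPred_eq, h0, mul_zero] at hy
    exact lt_irrefl _ hy
  · intro z
    have hpos : 0 < ‖w z‖⁻¹ := inv_pos.2 (lt_of_le_of_ne (norm_nonneg _) (hw0 z).symm)
    refine ⟨?_, ?_, ?_⟩
    · rw [norm_smul, norm_inv, norm_norm, inv_mul_cancel₀ (hw0 z)]
    · simp only [mem_ofPred_eq, Pi.smul_apply, hwi, smul_eq_mul]
      have := mul_self_pos.2 hi
      nlinarith [mul_pos hpos this]
    · ext j
      simp only [Pi.smul_apply, hwi, hwj, smul_eq_mul]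
      have := hw0 z
      field_simp
  · intro y hy hy1
    have hyi : y i ≠ 0 := fun h0 => by
      rw [mem_ofPred_eq, h0, mul_zero] at hy
      exact lt_irrefl _ hy
    have hc : 0 < x i / y i := by
      have h : x i / y i = (x i * y i) / (y i * y i) := by field_simp
      rw [h]
      exact div_pos hy (mul_self_pos.2 hyi)
    have hwy : w (fun j => x i / y i * y (i.succAbove j)) = (x i / y i) • y := by
      ext j
      rcases Fin.eq_self_or_eq_succAbove i j with rfl | ⟨j, rfl⟩
      · rw [hwi, Pi.smul_apply, smul_eq_mul, div_mul_cancel₀ _ hyi]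
      · rw [hwj, Pi.smul_apply, smul_eq_mul]
    change ‖w _‖⁻¹ • w _ = y
    rw [hwy, norm_smul, hy1, mul_one, Real.norm_of_nonneg hc.le, smul_smul,
      inv_mul_cancel₀ hc.ne', one_smul]

/-- Invariance of domain for maps from a Euclidean space to a sphere. -/
theorem image_mem_nhdsWithin_sphere {m : ℕ} {O : Set (Fin m → ℝ)} {y₀ : Fin m → ℝ}
    (hO : O ∈ 𝓝 y₀) {g : (Fin m → ℝ) → Fin (m + 1) → ℝ} (hg : ContinuousOn g O)
    (hinj : InjOn g O) (hmaps : ∀ y ∈ O, ‖g y‖ = 1) :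
    g '' O ∈ 𝓝[sphere 0 1] (g y₀) := by
  obtain ⟨N, φ, χ, hN, hxN, hφ, hχ, hφχ, hχφ⟩ :=
    exists_sphere_chart (hmaps y₀ (mem_of_mem_nhds hO))
  have hO' : O ∩ g ⁻¹' N ∈ 𝓝 y₀ :=
    Filter.inter_mem hO ((hg.continuousAt hO).preimage_mem_nhds (hN.mem_nhds hxN))
  have h := image_mem_nhds_of_injOn (f := χ ∘ g) hO'
    (hχ.comp (hg.mono inter_subset_left) fun y hy => hy.2) (by
      intro y hy z hz hyz
      apply hinj hy.1 hz.1
      rw [← hχφ _ hy.2 (hmaps y hy.1), ← hχφ _ hz.2 (hmaps z hz.1)]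
      exact congrArg φ hyz)
  have h2 := (hχ.continuousAt (hN.mem_nhds hxN)).preimage_mem_nhds h
  filter_upwards [nhdsWithin_le_nhds h2, nhdsWithin_le_nhds (hN.mem_nhds hxN),
    self_mem_nhdsWithin] with y hy hyN hy1
  obtain ⟨z, hz, hzy⟩ := hy
  refine ⟨z, hz.1, ?_⟩
  rw [← hχφ y hyN (by simpa using hy1), ← hzy]
  exact (hχφ _ hz.2 (hmaps z hz.1)).symm

/-- Pulling back a neighbourhood in the sphere, and an embedding of it, along a chart. -/
theorem exists_nhds_injOn_of_sphere {m : ℕ} {T : Set (Fin (m + 1) → ℝ)} {x : Fin (m + 1) → ℝ}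
    (hx : ‖x‖ = 1) (hT : T ∈ 𝓝[sphere 0 1] x) {k : ℕ} {g : (Fin (m + 1) → ℝ) → Fin k → ℝ}
    (hg : ContinuousOn g (T ∩ sphere 0 1)) (hinj : InjOn g (T ∩ sphere 0 1)) :
    ∃ (φ : (Fin m → ℝ) → Fin (m + 1) → ℝ) (V : Set (Fin m → ℝ)) (z : Fin m → ℝ),
      φ z = x ∧ V ∈ 𝓝 z ∧ MapsTo φ V (T ∩ sphere 0 1) ∧ ContinuousOn (g ∘ φ) V ∧
      InjOn (g ∘ φ) V := by
  obtain ⟨N, φ, χ, hN, hxN, hφ, hχ, hφχ, hχφ⟩ := exists_sphere_chart hx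
  have hmaps : MapsTo φ (φ ⁻¹' T) (T ∩ sphere 0 1) := fun z hz => ⟨hz, by simp [(hφχ z).1]⟩
  refine ⟨φ, φ ⁻¹' T, χ x, hχφ x hxN hx, ?_, hmaps, hg.comp hφ.continuousOn hmaps,
    hinj.comp ?_ hmaps⟩
  · have h1 : Filter.Tendsto φ (𝓝 (χ x)) (𝓝[sphere 0 1] x) := by
      refine tendsto_nhdsWithin_iff.2 ⟨?_, Filter.Eventually.of_forall fun z => by
        simp [(hφχ z).1]⟩
      have := hφ.tendsto (χ x)
      rwa [hχφ x hxN hx] at this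
    exact h1 hT
  · intro z _ w _ hzw
    rw [← (hφχ z).2.2, ← (hφχ w).2.2, hzw]

/-- Invariance of domain for maps from a sphere to a Euclidean space. -/
theorem image_mem_nhds_of_sphere {m : ℕ} {T : Set (Fin (m + 1) → ℝ)} {x : Fin (m + 1) → ℝ}
    (hx : ‖x‖ = 1) (hT : T ∈ 𝓝[sphere 0 1] x) {g : (Fin (m + 1) → ℝ) → Fin m → ℝ}
    (hg : ContinuousOn g (T ∩ sphere 0 1)) (hinj : InjOn g (T ∩ sphere 0 1)) :
    g '' (T ∩ sphere 0 1) ∈ 𝓝 (g x) := by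
  obtain ⟨φ, V, z, rfl, hV, hmaps, hc, hi⟩ := exists_nhds_injOn_of_sphere hx hT hg hinj
  refine Filter.mem_of_superset (image_mem_nhds_of_injOn hV hc hi) ?_
  rintro _ ⟨w, hw, rfl⟩
  exact ⟨φ w, hmaps hw, rfl⟩

/-- Invariance of dimension for maps from a sphere to a Euclidean space. -/
theorem not_injOn_of_sphere {n k : ℕ} (hk : k + 1 < n) {T : Set (Fin n → ℝ)} {x : Fin n → ℝ}
    (hx : ‖x‖ = 1) (hT : T ∈ 𝓝[sphere 0 1] x) {g : (Fin n → ℝ) → Fin k → ℝ}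
    (hg : ContinuousOn g (T ∩ sphere 0 1)) : ¬ InjOn g (T ∩ sphere 0 1) := by
  intro hinj
  obtain ⟨m, rfl⟩ : ∃ m, n = m + 1 := ⟨n - 1, by omega⟩
  obtain ⟨φ, V, z, rfl, hV, hmaps, hc, hi⟩ := exists_nhds_injOn_of_sphere hx hT hg hinj
  exact not_injOn_of_lt (by omega) hV hc hi

/-- A sphere has no boundary points: no neighbourhood of a point of the `m`-sphere is covered by an
embedded `m`-ball with the point on the boundary of the ball. -/
theorem not_subset_image_closedBall_of_sphere {m n : ℕ} (hmn : m + 1 = n) {T : Set (Fin n → ℝ)}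
    {ι : (Fin m → ℝ) → Fin n → ℝ} (hι : ContinuousOn ι (closedBall 0 1))
    (hinj : InjOn ι (closedBall 0 1)) {y : Fin m → ℝ} (hy : ‖y‖ = 1) (hιy : ‖ι y‖ = 1)
    (hT : T ∈ 𝓝[sphere 0 1] (ι y)) : ¬ T ∩ sphere 0 1 ⊆ ι '' closedBall 0 1 := by
  subst hmn
  intro hsub
  obtain ⟨g, hg, hgι⟩ := exists_continuousOn_leftInverse (isCompact_closedBall 0 1) hι hinj
  have hyB : y ∈ closedBall (0 : Fin m → ℝ) 1 := by simp [hy]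
  have h := image_mem_nhds_of_sphere hιy hT (hg.mono hsub) (by
    intro a ha b hb hab
    obtain ⟨a, haB, rfl⟩ := hsub ha
    obtain ⟨b, hbB, rfl⟩ := hsub hb
    rw [hgι a haB, hgι b hbB] at hab
    rw [hab])
  rw [hgι y hyB] at h
  have h2 : closedBall (0 : Fin m → ℝ) 1 ∈ 𝓝 y := by
    refine Filter.mem_of_superset h ?_
    rintro _ ⟨a, ha, rfl⟩
    obtain ⟨a, haB, rfl⟩ := hsub ha
    rwa [hgι a haB]
  rw [← mem_interior_iff_mem_nhds, interior_closedBall _ one_ne_zero, mem_ball_zero_iff, hy] at h2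
  exact lt_irrefl _ h2

/-- A closed subset of the sphere `∂Bⁿ` that locally embeds in `ℝᵏ` with `k ≤ n - 3` does not
separate small neighbourhoods of a point in the sphere. -/
theorem exists_isPreconnected_diff_of_sphere {n k : ℕ} (hk : k + 3 ≤ n) {T F : Set (Fin n → ℝ)}
    {x : Fin n → ℝ} (hx : ‖x‖ = 1) (hT : T ∈ 𝓝[sphere 0 1] x) (hF : IsClosed F)
    {g : (Fin n → ℝ) → Fin k → ℝ} (hg : ContinuousOn g (T ∩ sphere 0 1 ∩ F))
    (hinj : InjOn g (T ∩ sphere 0 1 ∩ F)) :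
    ∃ Y ⊆ T ∩ sphere 0 1, Y ∈ 𝓝[sphere 0 1] x ∧ IsPreconnected (Y \ F) := by
  obtain ⟨m, rfl⟩ : ∃ m, n = m + 1 := ⟨n - 1, by omega⟩
  obtain ⟨N, φ, χ, hN, hxN, hφ, hχ, hφχ, hχφ⟩ := exists_sphere_chart hx
  have hφ1 : ∀ z, φ z ∈ sphere (0 : Fin (m + 1) → ℝ) 1 := fun z => by simp [(hφχ z).1]
  have hT' : φ ⁻¹' T ∈ 𝓝 (χ x) := by
    have h1 : Filter.Tendsto φ (𝓝 (χ x)) (𝓝[sphere 0 1] x) := by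
      refine tendsto_nhdsWithin_iff.2 ⟨?_, Filter.Eventually.of_forall hφ1⟩
      have := hφ.tendsto (χ x)
      rwa [hχφ x hxN hx] at this
    exact h1 hT
  obtain ⟨r, hr, hrT⟩ := Metric.mem_nhds_iff.1 hT'
  have hmaps : MapsTo φ (ball (χ x) r ∩ φ ⁻¹' F) (T ∩ sphere 0 1 ∩ F) := fun z hz =>
    ⟨⟨hrT hz.1, hφ1 z⟩, hz.2⟩
  have hφi : Function.Injective φ := fun z w hzw => by
    rw [← (hφχ z).2.2, ← (hφχ w).2.2, hzw]
  refine ⟨φ '' ball (χ x) r, ?_, ?_, ?_⟩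
  · rintro _ ⟨z, hz, rfl⟩
    exact ⟨hrT hz, hφ1 z⟩
  · filter_upwards [nhdsWithin_le_nhds ((hχ.continuousAt (hN.mem_nhds hxN)).preimage_mem_nhds
      (ball_mem_nhds _ hr)), nhdsWithin_le_nhds (hN.mem_nhds hxN), self_mem_nhdsWithin]
      with y hy hyN hy1
    exact ⟨χ y, hy, hχφ y hyN (by simpa using hy1)⟩
  · have h : φ '' ball (χ x) r \ F = φ '' (ball (χ x) r \ φ ⁻¹' F) := by
      ext y
      constructor
      · rintro ⟨⟨z, hz, rfl⟩, hzF⟩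
        exact ⟨z, ⟨hz, hzF⟩, rfl⟩
      · rintro ⟨z, ⟨hz, hzF⟩, rfl⟩
        exact ⟨⟨z, hz, rfl⟩, hzF⟩
    rw [h]
    exact (isPreconnected_diff_of_injOn (by omega) isOpen_ball (convex_ball _ _)
      (hF.preimage hφ) (hg.comp hφ.continuousOn hmaps)
      (hinj.comp hφi.injOn hmaps)).image φ hφ.continuousOn

end Sphere
end FiniteCW

/-! ### Cells, normality and lifts of characteristic maps -/

namespace FiniteCW

variable {X : Type*} [TopologicalSpace X] {C : Set X} [CWComplex C]

namespace Cell

theorem continuousOn_charMap (e : Cell C) : ContinuousOn e.charMap (closedBall 0 1) :=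
  RelCWComplex.continuousOn e.dim e.idx

theorem injOn_charMap_ball (e : Cell C) : InjOn e.charMap (ball 0 1) := by
  have := (RelCWComplex.map e.dim e.idx).injOn
  rwa [RelCWComplex.source_eq] at this

theorem charMap_mem_openCell (e : Cell C) {x : Fin e.dim → ℝ} (hx : ‖x‖ < 1) :
    e.charMap x ∈ e.openCell :=
  ⟨x, mem_ball_zero_iff.2 hx, rfl⟩

theorem charMap_mem_closedCell (e : Cell C) {x : Fin e.dim → ℝ} (hx : ‖x‖ ≤ 1) :
    e.charMap x ∈ e.closedCell :=
  ⟨x, mem_closedBall_zero_iff.2 hx, rfl⟩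

theorem exists_continuousOn_inverse (e : Cell C) : ∃ g : X → Fin e.dim → ℝ,
    ContinuousOn g e.openCell ∧ ∀ x ∈ ball 0 1, g (e.charMap x) = x := by
  have hs := RelCWComplex.source_eq (C := C) e.dim e.idx
  refine ⟨(RelCWComplex.map e.dim e.idx).symm, ?_, fun x hx => ?_⟩
  · have h := RelCWComplex.continuousOn_symm (C := C) e.dim e.idx
    rwa [← PartialEquiv.image_source_eq_target, hs] at h
  · exact (RelCWComplex.map e.dim e.idx).left_inv (hs ▸ hx)

theorem exists_mem_openCell_of_norm_eq_one (e : Cell C) {x : Fin e.dim → ℝ} (hx : ‖x‖ = 1) :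
    ∃ s : Cell C, s.dim < e.dim ∧ e.charMap x ∈ s.openCell := by
  obtain ⟨I, hI⟩ := CWComplex.cellFrontier_subset_finite_openCell e.dim e.idx
  have hx' : e.charMap x ∈ RelCWComplex.cellFrontier e.dim e.idx := ⟨x, by simpa using hx, rfl⟩
  have := hI hx'
  simp only [mem_iUnion] at this
  obtain ⟨m, hm, j, -, hj⟩ := this
  exact ⟨⟨m, j⟩, hm, hj⟩

theorem exists_mem_openCell (e : Cell C) {x : Fin e.dim → ℝ} (hx : ‖x‖ ≤ 1) :
    ∃ s : Cell C, s.dim ≤ e.dim ∧ e.charMap x ∈ s.openCell := by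
  rcases hx.eq_or_lt with h | h
  · obtain ⟨s, hs, hxs⟩ := e.exists_mem_openCell_of_norm_eq_one h
    exact ⟨s, hs.le, hxs⟩
  · exact ⟨e, le_rfl, e.charMap_mem_openCell h⟩

/-- The preimage of the open cell in the closed ball is the open ball. -/
theorem norm_lt_one_of_mem (e : Cell C) {x : Fin e.dim → ℝ} (hx : ‖x‖ ≤ 1)
    (h : e.charMap x ∈ e.openCell) : ‖x‖ < 1 := by
  refine lt_of_le_of_ne hx fun h1 => ?_
  obtain ⟨s, hs, hxs⟩ := e.exists_mem_openCell_of_norm_eq_one h1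
  rw [eq_of_mem hxs h] at hs
  exact lt_irrefl _ hs

theorem norm_eq_one_of_mem (e : Cell C) {s : Cell C} {x : Fin e.dim → ℝ} (hx : ‖x‖ ≤ 1)
    (h : e.charMap x ∈ s.openCell) (hs : s ≠ e) : ‖x‖ = 1 := by
  by_contra hne
  exact hs (eq_of_mem h (e.charMap_mem_openCell (lt_of_le_of_ne hx hne)))

/-- A characteristic map is injective as soon as it is injective on the boundary of the ball. -/
theorem injOn_charMap_of_sphere {e : Cell C} (h : InjOn e.charMap (sphere 0 1)) :
    InjOn e.charMap (closedBall 0 1) := by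
  intro x hx y hy hxy
  rw [mem_closedBall_zero_iff] at hx hy
  rcases hx.eq_or_lt with hx1 | hx1
  · obtain ⟨s, hs, hxs⟩ := e.exists_mem_openCell_of_norm_eq_one hx1
    have hy1 : ‖y‖ = 1 := e.norm_eq_one_of_mem hy (hxy ▸ hxs) fun h => by
      rw [h] at hs; exact lt_irrefl _ hs
    exact h (by simpa using hx1) (by simpa using hy1) hxy
  · have hy1 : ‖y‖ < 1 := e.norm_lt_one_of_mem hy (hxy ▸ e.charMap_mem_openCell hx1)
    exact e.injOn_charMap_ball (by simpa using hx1) (by simpa using hy1) hxy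

theorem mem_sphere_of_mem_codimOnePreimage {e : Cell C} {x : Fin e.dim → ℝ}
    (hx : x ∈ e.codimOnePreimage) : x ∈ sphere (0 : Fin e.dim → ℝ) 1 := by
  obtain ⟨hx1, s, hs, hxs⟩ := hx
  simpa using e.norm_eq_one_of_mem (by simpa using hx1) hxs fun h => by rw [h] at hs; omega

theorem isCompact_closedCell (e : Cell C) : IsCompact e.closedCell :=
  RelCWComplex.isCompact_closedCell

instance finite [CWComplex.Finite C] : Finite (Cell C) := by
  have h := RelCWComplex.FiniteDimensional.eventually_isEmpty_cell (C := C) (D := ∅)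
  obtain ⟨N, hN⟩ := Filter.eventually_atTop.1 h
  have hfin : ∀ n, Finite (RelCWComplex.cell C n) := RelCWComplex.FiniteType.finite_cell
  let F : Cell C → Σ n : Fin N, RelCWComplex.cell C n := fun e =>
    ⟨⟨e.dim, by
      by_contra hcon
      exact (hN e.dim (not_lt.1 hcon)).false e.idx⟩, e.idx⟩
  refine Finite.of_injective F ?_
  rintro ⟨n, i⟩ ⟨m, j⟩ h
  simp only [F, Sigma.mk.injEq, Fin.mk.injEq] at h
  obtain ⟨rfl, h⟩ := h
  simpa using h

variable [T2Space X]

theorem isClosed_closedCell (e : Cell C) : IsClosed e.closedCell :=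
  e.isCompact_closedCell.isClosed

theorem closure_openCell (e : Cell C) : closure e.openCell = e.closedCell :=
  RelCWComplex.closure_openCell_eq_closedCell

theorem le_iff {s t : Cell C} : s ≤ t ↔ s.openCell ⊆ t.closedCell := by
  rw [← closure_openCell]; rfl

theorem closedCell_subset {s t : Cell C} (h : s ≤ t) : s.closedCell ⊆ t.closedCell := by
  rw [← closure_openCell s]
  exact closure_minimal (le_iff.1 h) t.isClosed_closedCell

theorem dim_lt_of_lt {s t : Cell C} (h : s < t) : s.dim < t.dim :=
  (eq_or_dim_lt h.le).resolve_left h.ne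

theorem lt_of_le_of_dim_lt {s t : Cell C} (h : s ≤ t) (hd : s.dim < t.dim) : s < t :=
  lt_of_le_of_ne h fun he => by rw [he] at hd; exact lt_irrefl _ hd

end Cell

/-- A CW complex is normal if an open cell is contained in every closed cell that it meets. -/
def IsNormal [T2Space X] (C : Set X) [CWComplex C] : Prop :=
  ∀ (s t : Cell C) (x : X), x ∈ s.openCell → x ∈ t.closedCell → s ≤ t

theorem isNormal_of_closedCell_eq [T2Space X]
    (h : ∀ e : Cell C, ∃ S : Set (Cell C), e.closedCell = ⋃ s ∈ S, s.openCell) : IsNormal C := by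
  intro s t x hs ht
  obtain ⟨S, hS⟩ := h t
  rw [hS] at ht
  simp only [mem_iUnion] at ht
  obtain ⟨s', hs', hx⟩ := ht
  rw [Cell.eq_of_mem hs hx, Cell.le_iff, hS]
  exact subset_biUnion_of_mem (u := fun s : Cell C => s.openCell) hs'

namespace Cell

/-- `ι` is an embedding of the closed ball of `s` into that of `e` over the characteristic maps;
only its values on `closedBall 0 1` are meaningful. -/
structure IsLift (s e : Cell C) (ι : (Fin s.dim → ℝ) → Fin e.dim → ℝ) : Prop where
  continuousOn : ContinuousOn ι (closedBall 0 1)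
  injOn : InjOn ι (closedBall 0 1)
  norm_le : ∀ x, ‖x‖ ≤ 1 → ‖ι x‖ ≤ 1
  charMap : ∀ x, ‖x‖ ≤ 1 → e.charMap (ι x) = s.charMap x

theorem factorsThrough_iff {s e : Cell C} : s.FactorsThrough e ↔ ∃ ι, IsLift s e ι := by
  constructor
  · classical
    rintro ⟨ι, hι, h⟩
    let r : (Fin s.dim → ℝ) → closedBall (0 : Fin s.dim → ℝ) 1 := fun x =>
      if hx : x ∈ closedBall (0 : Fin s.dim → ℝ) 1 then ⟨x, hx⟩ else ⟨0, by simp⟩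
    have hr : ∀ x : closedBall (0 : Fin s.dim → ℝ) 1, r x = x := fun x => dif_pos x.2
    have hr' : ∀ x (hx : ‖x‖ ≤ 1), r x = ⟨x, mem_closedBall_zero_iff.2 hx⟩ := fun x hx =>
      hr ⟨x, mem_closedBall_zero_iff.2 hx⟩
    refine ⟨fun x => ι (r x), ?_, ?_, fun x _ => mem_closedBall_zero_iff.1 (ι (r x)).2, ?_⟩
    · rw [continuousOn_iff_continuous_domRestrict]
      refine (continuous_subtype_val.comp hι.continuous).congr fun x => ?_
      simp [hr]
    · intro x hx y hy hxy
      have := hι.injective (Subtype.ext hxy)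
      rw [hr ⟨x, hx⟩, hr ⟨y, hy⟩] at this
      exact congrArg Subtype.val this
    · intro x hx
      rw [h, hr' x hx]
  · rintro ⟨ι, hι⟩
    refine ⟨fun x => ⟨ι x, mem_closedBall_zero_iff.2
      (hι.norm_le x (mem_closedBall_zero_iff.1 x.2))⟩,
      ?_, fun x => hι.charMap x (mem_closedBall_zero_iff.1 x.2)⟩
    have hc : CompactSpace (closedBall (0 : Fin s.dim → ℝ) 1) :=
      isCompact_iff_compactSpace.1 (isCompact_closedBall _ _)
    refine (Continuous.isClosedEmbedding ?_ ?_).isEmbedding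
    · exact Continuous.subtype_mk (continuousOn_iff_continuous_domRestrict.1 hι.continuousOn) _
    · intro x y hxy
      exact Subtype.ext (hι.injOn x.2 y.2 (congrArg Subtype.val hxy))

end Cell

/-- Injectivity of the characteristic maps is all that regularity adds to the first condition. -/
theorem isRegular_of_injOn [T2Space X] [CWComplex.Finite C]
    (h : ∀ e : Cell C, ∃ S : Set (Cell C), e.closedCell = ⋃ s ∈ S, s.openCell)
    (hinj : ∀ e : Cell C, InjOn e.charMap (sphere 0 1)) : IsRegular C := by
  intro e
  refine ⟨?_, {s | (s.openCell ∩ e.charMap '' sphere 0 1).Nonempty}, Set.toFinite _, ?_, ?_⟩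
  · have hc : CompactSpace (sphere (0 : Fin e.dim → ℝ) 1) :=
      isCompact_iff_compactSpace.1 (isCompact_sphere _ _)
    refine (Continuous.isClosedEmbedding ?_ (injOn_iff_injective.1 (hinj e))).isEmbedding
    exact continuousOn_iff_continuous_domRestrict.1
      (e.continuousOn_charMap.mono sphere_subset_closedBall)
  · rintro s ⟨_, hs, x, hx, rfl⟩
    obtain ⟨t, ht, hxt⟩ := e.exists_mem_openCell_of_norm_eq_one (by simpa using hx)
    rwa [Cell.eq_of_mem hs hxt]
  · ext p
    simp only [mem_iUnion]
    constructor
    · rintro ⟨x, hx, rfl⟩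
      obtain ⟨t, -, hxt⟩ := e.exists_mem_openCell_of_norm_eq_one (by simpa using hx)
      exact ⟨t, ⟨_, hxt, x, hx, rfl⟩, hxt⟩
    · rintro ⟨s, ⟨_, hs, x, hx, rfl⟩, hp⟩
      have hx1 : ‖x‖ = 1 := by simpa using hx
      obtain ⟨t, ht, hxt⟩ := e.exists_mem_openCell_of_norm_eq_one hx1
      obtain rfl := Cell.eq_of_mem hs hxt
      have hle := isNormal_of_closedCell_eq h s e _ hs (e.charMap_mem_closedCell hx1.le)
      obtain ⟨y, hy, rfl⟩ := Cell.le_iff.1 hle hp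
      refine ⟨y, ?_, rfl⟩
      simpa using e.norm_eq_one_of_mem (by simpa using hy) hp
        fun h => by rw [h] at ht; exact lt_irrefl _ ht

section Poset

variable {P : Type*} [PartialOrder P]

theorem ncard_Icc_eq_four_iff [Finite P] {u v : P} (huv : u < v) :
    (Icc u v).ncard = 4 ↔ (Ioo u v).ncard = 2 := by
  have h : Icc u v = insert u (insert v (Ioo u v)) := by
    rw [Set.Ioo_insert_right huv, Set.Ioc_insert_left huv.le]
  rw [h, Set.ncard_insert_of_notMem, Set.ncard_insert_of_notMem]
  · omega
  · simp
  · simp [huv.ne]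

/-- A property that passes to comparable elements holds throughout a connected interval. -/
theorem IsConnectedInterval.induction {u v : P} (h : IsConnectedInterval u v) {p : P → Prop}
    (hp : ∀ a ∈ Ioo u v, ∀ b ∈ Ioo u v, a < b → (p a ↔ p b)) {a b : P} (ha : a ∈ Ioo u v)
    (hb : b ∈ Ioo u v) (hpa : p a) : p b := by
  obtain ⟨w⟩ := h.preconnected ⟨a, ha⟩ ⟨b, hb⟩
  have key : ∀ (x y : Ioo u v),
      (SimpleGraph.fromRel fun a b : Ioo u v => a < b).Walk x y → p x → p y := by
    intro x y w
    induction w with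
    | nil => exact id
    | @cons x z y hadj _ ih =>
      intro hpx
      apply ih
      rcases ((SimpleGraph.fromRel_adj _ _ _).1 hadj).2 with h | h
      · exact (hp x x.2 z z.2 h).1 hpx
      · exact (hp z z.2 x x.2 h).2 hpx
  exact key _ _ w hpa

end Poset

end FiniteCW

/-! ### The conditions imply that the characteristic maps are injective -/

namespace FiniteCW

variable {X : Type*} [TopologicalSpace X] {C : Set X} [CWComplex C]

theorem closureRank_coe (e : Cell C) : closureRank (e : ClosurePoset C) = e.dim + 1 := rfl

instance [CWComplex.Finite C] : Finite (ClosurePoset C) :=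
  inferInstanceAs (Finite (Option (Cell C)))

section Regularity

namespace Cell

/-- If the characteristic map of `e` is injective over the open cell `w`, the lifts of `w` and of a
larger cell `r` to the ball of `e` agree over the open cell `w`, hence over the closed one. -/
theorem IsLift.eq_of_le {e w r : Cell C} {j : (Fin w.dim → ℝ) → Fin e.dim → ℝ}
    {k : (Fin r.dim → ℝ) → Fin e.dim → ℝ} (hj : IsLift w e j) (hk : IsLift r e k)
    (hwr : w.FactorsThrough r) (hr : InjOn r.charMap (closedBall 0 1))
    (hw : InjOn e.charMap {x | ‖x‖ ≤ 1 ∧ e.charMap x ∈ w.openCell})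
    {y : Fin w.dim → ℝ} (hy : ‖y‖ ≤ 1) {z : Fin r.dim → ℝ} (hz : ‖z‖ ≤ 1)
    (hyz : w.charMap y = r.charMap z) : j y = k z := by
  obtain ⟨l, hl⟩ := factorsThrough_iff.1 hwr
  have hmaps : MapsTo l (closedBall 0 1) (closedBall 0 1) := fun x hx => by
    simpa using hl.norm_le x (by simpa using hx)
  have heq : EqOn j (k ∘ l) (ball 0 1) := by
    intro x hx
    have hx1 : ‖x‖ < 1 := mem_ball_zero_iff.1 hx
    have hlx := hl.norm_le x hx1.le
    have h1 := hj.charMap x hx1.le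
    have h2 : e.charMap (k (l x)) = w.charMap x :=
      (hk.charMap _ hlx).trans (hl.charMap x hx1.le)
    have hxw := w.charMap_mem_openCell hx1
    exact hw ⟨hj.norm_le x hx1.le, h1 ▸ hxw⟩ ⟨hk.norm_le _ hlx, h2 ▸ hxw⟩ (h1.trans h2.symm)
  have heq' : EqOn j (k ∘ l) (closedBall 0 1) :=
    heq.of_subset_closure hj.continuousOn (hk.continuousOn.comp hl.continuousOn hmaps)
      ball_subset_closedBall (by rw [closure_ball _ one_ne_zero])
  rw [heq' (by simpa using hy)]
  have : l y = z := hr (by simpa using hl.norm_le y hy) (by simpa using hz)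
    ((hl.charMap y hy).trans hyz)
  exact congrArg k this

variable [T2Space X]

/-- Every boundary point of the ball of `e` lies in the lift of a facet of `e`, because the facets
lift uniquely over their open cells and these lifts are dense. -/
theorem exists_facet_lift [CWComplex.Finite C] (hn : IsNormal C) {e : Cell C}
    (h2 : sphere 0 1 ⊆ closure e.codimOnePreimage) (h4 : InjOn e.charMap e.codimOnePreimage)
    {ι : ∀ s : Cell C, (Fin s.dim → ℝ) → Fin e.dim → ℝ} (hι : ∀ s ≤ e, IsLift s e (ι s))
    {x : Fin e.dim → ℝ} (hx : ‖x‖ = 1) :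
    ∃ r ≤ e, r.dim + 1 = e.dim ∧ ∃ y, ‖y‖ ≤ 1 ∧ ι r y = x := by
  have hclosed : IsClosed (⋃ r ∈ {r : Cell C | r ≤ e ∧ r.dim + 1 = e.dim},
      ι r '' closedBall 0 1) :=
    (Set.toFinite _).isClosed_biUnion fun r hr =>
      ((isCompact_closedBall _ _).image_of_continuousOn (hι r hr.1).continuousOn).isClosed
  have hsub : e.codimOnePreimage ⊆ ⋃ r ∈ {r : Cell C | r ≤ e ∧ r.dim + 1 = e.dim},
      ι r '' closedBall 0 1 := by
    rintro y ⟨hy, r, hr, hyr⟩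
    have hre : r ≤ e := hn r e _ hyr (e.charMap_mem_closedCell (by simpa using hy))
    obtain ⟨z, hz, hzy⟩ := id hyr
    have hz1 : ‖z‖ ≤ 1 := (mem_ball_zero_iff.1 hz).le
    have hzy' : e.charMap (ι r z) = e.charMap y := ((hι r hre).charMap z hz1).trans hzy
    refine mem_biUnion (show r ∈ {r : Cell C | r ≤ e ∧ r.dim + 1 = e.dim} from ⟨hre, hr⟩)
      ⟨z, by simpa using hz1, ?_⟩
    exact h4 ⟨by simpa using (hι r hre).norm_le z hz1, r, hr, hzy' ▸ hyr⟩ ⟨hy, r, hr, hyr⟩ hzy'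
  have := closure_minimal hsub hclosed (h2 (by simpa using hx))
  simp only [mem_iUnion] at this
  obtain ⟨r, ⟨hre, hr⟩, y, hy, hyx⟩ := this
  exact ⟨r, hre, hr, y, by simpa using hy, hyx⟩

/-- If two facets of `e` are the only ones above a cell `s` of codimension two, their lifts agree
over `s`: otherwise the boundary sphere of `e` would be covered near the lift of a point of `s` by
the lift of a single facet, with this point on the boundary of the facet. -/
theorem IsLift.eq_of_facets [CWComplex.Finite C] (hn : IsNormal C) {e s r r' : Cell C}
    (h2 : sphere 0 1 ⊆ closure e.codimOnePreimage) (h4 : InjOn e.charMap e.codimOnePreimage)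
    {ι : ∀ s : Cell C, (Fin s.dim → ℝ) → Fin e.dim → ℝ} (hι : ∀ s ≤ e, IsLift s e (ι s))
    (hdim : r.dim + 1 = e.dim) (hre : r ≤ e) (hsr : s ≠ r) (hse : s ≠ e)
    (honly : ∀ t ≤ e, t.dim + 1 = e.dim → s ≤ t → t = r ∨ t = r')
    (hr' : InjOn r'.charMap (closedBall 0 1))
    {y : Fin r.dim → ℝ} (hy : ‖y‖ ≤ 1) (hys : r.charMap y ∈ s.openCell)
    {z : Fin r'.dim → ℝ} (hz : ‖z‖ ≤ 1) (hyz : r.charMap y = r'.charMap z) :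
    ι r y = ι r' z := by
  by_contra hne
  have hy1 : ‖y‖ = 1 := r.norm_eq_one_of_mem hy hys hsr
  have hιy : e.charMap (ι r y) = r.charMap y := (hι r hre).charMap y hy
  have hιy1 : ‖ι r y‖ = 1 :=
    e.norm_eq_one_of_mem ((hι r hre).norm_le y hy) (hιy ▸ hys) hse
  -- The complement of the lifts of the other facets is a neighbourhood of `ι r y` in the sphere.
  let J : Set (Cell C) := {t | t ≤ e ∧ t.dim + 1 = e.dim ∧ t ≠ r}
  have hclosed : IsClosed (⋃ t ∈ J, ι t '' closedBall 0 1) :=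
    (Set.toFinite _).isClosed_biUnion fun t ht =>
      ((isCompact_closedBall _ _).image_of_continuousOn (hι t ht.1).continuousOn).isClosed
  have hmem : ι r y ∉ ⋃ t ∈ J, ι t '' closedBall 0 1 := by
    simp only [mem_iUnion]
    rintro ⟨t, ⟨hte, htd, htr⟩, a, ha, hay⟩
    have ha1 : ‖a‖ ≤ 1 := by simpa using ha
    have hta : t.charMap a = r.charMap y := by
      rw [← (hι t hte).charMap a ha1, hay, hιy]
    have hst : s ≤ t := hn s t _ hys (hta ▸ t.charMap_mem_closedCell ha1)
    rcases honly t hte htd hst with rfl | rfl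
    · exact htr rfl
    · refine hne (hay.symm.trans (congrArg (ι t) ?_))
      exact hr' ha (by simpa using hz) (hta.trans hyz)
  have hT : (⋃ t ∈ J, ι t '' closedBall 0 1)ᶜ ∈ 𝓝[sphere 0 1] (ι r y) :=
    mem_nhdsWithin_of_mem_nhds (hclosed.isOpen_compl.mem_nhds hmem)
  have hcover : (⋃ t ∈ J, ι t '' closedBall 0 1)ᶜ ∩ sphere 0 1 ⊆ ι r '' closedBall 0 1 := by
    rintro x ⟨hxJ, hx⟩
    obtain ⟨t, hte, htd, a, ha, rfl⟩ := exists_facet_lift hn h2 h4 hι (by simpa using hx)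
    by_cases htr : t = r
    · subst htr
      exact ⟨a, by simpa using ha, rfl⟩
    · have htJ : t ∈ J := ⟨hte, htd, htr⟩
      exact absurd (mem_biUnion htJ (mem_image_of_mem _ (by simpa using ha))) hxJ
  have hιr := hι r hre
  exact not_subset_image_closedBall_of_sphere hdim hιr.continuousOn hιr.injOn hy1 hιy1 hT hcover

end Cell

variable [T2Space X]

/-- The five conditions imply, by induction on the dimension of the cell, that all characteristic
maps are injective. Over a boundary cell `s` injectivity is shown by induction on the codimension
of `s`: all preimages of a point of `s` are lifts from facets, and the lifts from comparable cells
strictly between `s` and `e` agree, so connectedness of this interval gives the claim. -/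
theorem injOn_charMap_of_conditions [CWComplex.Finite C] (hn : IsNormal C)
    (h2 : ∀ e : Cell C, sphere 0 1 ⊆ closure e.codimOnePreimage)
    (hthin : IsThin (closureRank (C := C)))
    (hconn : ∀ u v : ClosurePoset C, u ≤ v → closureRank u + 2 < closureRank v →
      IsConnectedInterval u v)
    (h4 : ∀ e : Cell C, InjOn e.charMap e.codimOnePreimage)
    (h5 : ∀ s e : Cell C, s.openCell ⊆ closure e.openCell → s.FactorsThrough e) (e : Cell C) :
    InjOn e.charMap (closedBall 0 1) := by
  obtain ⟨n, hne⟩ : ∃ n, e.dim = n := ⟨_, rfl⟩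
  induction n using Nat.strong_induction_on generalizing e with
  | _ n ih =>
  subst hne
  have ih' : ∀ r : Cell C, r.dim < e.dim → InjOn r.charMap (closedBall 0 1) := fun r hr =>
    ih r.dim hr r rfl
  have hex : ∀ s : Cell C, ∃ ι : (Fin s.dim → ℝ) → Fin e.dim → ℝ, s ≤ e → Cell.IsLift s e ι := by
    intro s
    by_cases hs : s ≤ e
    · obtain ⟨ι, hι⟩ := Cell.factorsThrough_iff.1 (h5 s e hs)
      exact ⟨ι, fun _ => hι⟩
    · exact ⟨fun _ => 0, fun h => absurd h hs⟩
  choose ι hι using hex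
  suffices key : ∀ k, ∀ s : Cell C, s.dim + k = e.dim → s ≠ e →
      InjOn e.charMap {x | ‖x‖ ≤ 1 ∧ e.charMap x ∈ s.openCell} by
    refine Cell.injOn_charMap_of_sphere fun x hx x' hx' hxx => ?_
    have hx1 : ‖x‖ = 1 := by simpa using hx
    have hx1' : ‖x'‖ = 1 := by simpa using hx'
    obtain ⟨s, hs, hxs⟩ := e.exists_mem_openCell_of_norm_eq_one hx1
    exact key (e.dim - s.dim) s (by omega) (fun h => by rw [h] at hs; exact lt_irrefl _ hs)
      ⟨hx1.le, hxs⟩ ⟨hx1'.le, hxx ▸ hxs⟩ hxx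
  intro k
  induction k using Nat.strong_induction_on with
  | _ k ihk =>
  rintro s hk hse x ⟨hx, hxs⟩ x' ⟨hx', hxs'⟩ hxx
  have hse' : s ≤ e := hn s e _ hxs (e.charMap_mem_closedCell hx)
  have hdlt : s.dim < e.dim := Cell.dim_lt_of_lt (lt_of_le_of_ne hse' hse)
  by_cases hk1 : k = 1
  · subst hk1
    exact h4 e ⟨by simpa using hx, s, hk, hxs⟩ ⟨by simpa using hx', s, hk, hxs'⟩ hxx
  obtain ⟨r, hre, hrd, y, hy, rfl⟩ := Cell.exists_facet_lift hn (h2 e) (h4 e) hι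
    (e.norm_eq_one_of_mem hx hxs hse)
  obtain ⟨r', hre', hrd', y', hy', rfl⟩ := Cell.exists_facet_lift hn (h2 e) (h4 e) hι
    (e.norm_eq_one_of_mem hx' hxs' hse)
  have hιy := (hι r hre).charMap y hy
  have hιy' := (hι r' hre').charMap y' hy'
  have hyy : r.charMap y = r'.charMap y' := hιy.symm.trans (hxx.trans hιy')
  rw [hιy] at hxs
  rw [hιy'] at hxs'
  have hsr : s < r := Cell.lt_of_le_of_dim_lt
    (hn s r _ hxs (r.charMap_mem_closedCell hy)) (by omega)
  have hsr' : s < r' := Cell.lt_of_le_of_dim_lt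
    (hn s r' _ hxs' (r'.charMap_mem_closedCell hy')) (by omega)
  have hre1 : r < e := Cell.lt_of_le_of_dim_lt hre (by omega)
  have hre1' : r' < e := Cell.lt_of_le_of_dim_lt hre' (by omega)
  have hIoo : ∀ t : Cell C, s < t → t < e →
      (t : ClosurePoset C) ∈ Ioo (s : ClosurePoset C) (e : ClosurePoset C) := fun t h h' =>
    ⟨WithBot.coe_lt_coe.2 h, WithBot.coe_lt_coe.2 h'⟩
  by_cases hk2 : k = 2
  · by_cases hrr : r = r'
    · subst hrr
      exact congrArg (ι r) (ih' r (by omega) (by simpa using hy) (by simpa using hy') hyy)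
    have h4' := hthin.2 (s : ClosurePoset C) (e : ClosurePoset C) (WithBot.coe_le_coe.2 hse')
      (by rw [closureRank_coe, closureRank_coe]; omega)
    rw [ncard_Icc_eq_four_iff (WithBot.coe_lt_coe.2 (lt_of_le_of_ne hse' hse))] at h4'
    refine Cell.IsLift.eq_of_facets hn (h2 e) (h4 e) hι hrd hre hsr.ne hse ?_
      (ih' r' (by omega)) hy hxs hy' hyy
    intro t hte htd hst
    obtain ⟨a, b, -, hab⟩ := Set.ncard_eq_two.1 h4'
    have e1 := hIoo r hsr hre1
    have e2 := hIoo r' hsr' hre1'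
    have e3 := hIoo t (Cell.lt_of_le_of_dim_lt hst (by omega))
      (Cell.lt_of_le_of_dim_lt hte (by omega))
    rw [hab, mem_insert_iff, mem_singleton_iff] at e1 e2 e3
    have hrr' : (r : ClosurePoset C) ≠ r' := fun h => hrr (WithBot.coe_inj.1 h)
    have : (t : ClosurePoset C) = r ∨ (t : ClosurePoset C) = r' := by
      rcases e1 with e1 | e1 <;> rcases e2 with e2 | e2 <;> rcases e3 with e3 | e3 <;> simp_all
    simpa only [WithBot.coe_inj] using this
  · have hk0 : k ≠ 0 := by omega
    have hc := hconn (s : ClosurePoset C) (e : ClosurePoset C) (WithBot.coe_le_coe.2 hse')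
      (by rw [closureRank_coe, closureRank_coe]; omega)
    -- The lift of the point to the ball of `e` is the same for all cells of the interval.
    let p : ClosurePoset C → Prop := fun a => ∀ w : Cell C, a = w → ∀ z, ‖z‖ ≤ 1 →
      w.charMap z = r.charMap y → ι w z = ι r y
    have hpr : p r := by
      intro w hw z hz hzy
      obtain rfl : r = w := WithBot.coe_inj.1 hw
      exact congrArg (ι r) (ih' r (by omega) (by simpa using hz) (by simpa using hy) hzy)
    have hcell : ∀ a ∈ Ioo (s : ClosurePoset C) (e : ClosurePoset C), ∃ w : Cell C, a = w ∧
        s < w ∧ w < e ∧ ∃ z, ‖z‖ ≤ 1 ∧ w.charMap z = r.charMap y := by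
      rintro a ⟨ha, ha'⟩
      obtain ⟨w, rfl⟩ := WithBot.ne_bot_iff_exists.1 (ne_bot_of_gt ha)
      have hsw : s < w := WithBot.coe_lt_coe.1 ha
      obtain ⟨z, hz, hzy⟩ := Cell.le_iff.1 hsw.le hxs
      exact ⟨w, rfl, hsw, WithBot.coe_lt_coe.1 ha', z, by simpa using hz, hzy⟩
    refine (hc.induction (p := p) ?_ (hIoo r hsr hre1) (hIoo r' hsr' hre1') hpr r' rfl y' hy'
      hyy.symm).symm
    intro a ha b hb hab
    obtain ⟨w, rfl, hsw, hwe, z, hz, hzy⟩ := hcell a ha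
    obtain ⟨w', rfl, hsw', hwe', z', hz', hzy'⟩ := hcell b hb
    have hww : w < w' := WithBot.coe_lt_coe.1 hab
    have hd1 := Cell.dim_lt_of_lt hsw
    have hd2 := Cell.dim_lt_of_lt hwe
    have heq : ∀ a b, ‖a‖ ≤ 1 → ‖b‖ ≤ 1 → w.charMap a = r.charMap y →
        w'.charMap b = r.charMap y → ι w a = ι w' b := fun a b ha hb hay hby =>
      (hι w hwe.le).eq_of_le (hι w' hwe'.le) (h5 w w' hww.le) (ih' w' (Cell.dim_lt_of_lt hwe'))
        (ihk (e.dim - w.dim) (by omega) w (by omega) hwe.ne) ha hb (hay.trans hby.symm)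
    constructor
    · intro hpa v hv b hb hby
      obtain rfl : w' = v := WithBot.coe_inj.1 hv
      rw [← heq z b hz hb hzy hby]
      exact hpa w rfl z hz hzy
    · intro hpb v hv a ha hay
      obtain rfl : w = v := WithBot.coe_inj.1 hv
      rw [heq a z' ha hz' hay hzy']
      exact hpb w' rfl z' hz' hzy'

end Regularity

end FiniteCW

/-! ### Gluing two balls, and density of the cells of codimension one -/

namespace FiniteCW

section Doubling

/-- Two embedded `m`-balls in the `m`-sphere that meet along a common piece `W` of their boundaries,
near a point of `W`, together cover a neighbourhood of this point. The two balls are glued to a map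
on a neighbourhood of a boundary point in `ℝᵐ`, the second one by inversion in the unit sphere, and
invariance of domain applies. -/
theorem image_union_image_mem_nhdsWithin {m m' n : ℕ} (hmn : m + 1 = n)
    (hmn' : m' + 1 = n) {h₁ : (Fin m → ℝ) → Fin n → ℝ} {h₂ : (Fin m' → ℝ) → Fin n → ℝ}
    (hc₁ : ContinuousOn h₁ (closedBall 0 1)) (hc₂ : ContinuousOn h₂ (closedBall 0 1))
    (hi₁ : InjOn h₁ (closedBall 0 1)) (hi₂ : InjOn h₂ (closedBall 0 1))
    (hn₁ : ∀ y, ‖y‖ ≤ 1 → ‖h₁ y‖ = 1) (hn₂ : ∀ y, ‖y‖ ≤ 1 → ‖h₂ y‖ = 1)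
    {W : Set (Fin n → ℝ)} {y₁ : Fin m → ℝ} (hy₁ : ‖y₁‖ = 1)
    (hW₁ : ∀ᶠ y in 𝓝[sphere 0 1] y₁, h₁ y ∈ W) (hW₂ : W ⊆ h₂ '' sphere 0 1)
    (hd : ∀ y z, ‖y‖ < 1 → ‖z‖ < 1 → h₁ y ≠ h₂ z) (hdW : ∀ z, ‖z‖ < 1 → h₂ z ∉ W) :
    h₁ '' closedBall 0 1 ∪ h₂ '' closedBall 0 1 ∈ 𝓝[sphere 0 1] (h₁ y₁) := by
  obtain rfl : m = m' := by omega
  subst hmn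
  obtain ⟨g, hg, hgh⟩ := exists_continuousOn_leftInverse (isCompact_closedBall 0 1) hc₂ hi₂
  have hmem : ∀ {y : Fin m → ℝ}, ‖y‖ ≤ 1 → y ∈ closedBall (0 : Fin m → ℝ) 1 := fun h => by
    simpa using h
  obtain ⟨V, hV, hVW⟩ := mem_nhdsWithin_iff_exists_mem_nhds_inter.1 hW₁
  let ν : (Fin m → ℝ) → Fin m → ℝ := fun y => ‖y‖⁻¹ • y
  have hν0 : ContinuousOn ν {y | y ≠ 0} :=
    (continuous_norm.continuousOn.inv₀ fun y hy => norm_ne_zero_iff.2 hy).smul continuousOn_id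
  have hν1 : ∀ {y : Fin m → ℝ}, y ≠ 0 → ‖ν y‖ = 1 := fun {y} hy => by
    rw [norm_smul, norm_inv, norm_norm, inv_mul_cancel₀ (norm_ne_zero_iff.2 hy)]
  have hνid : ∀ {y : Fin m → ℝ}, ‖y‖ = 1 → ν y = y := fun {y} hy => by
    simp only [ν, hy, inv_one, one_smul]
  have hy0 : y₁ ≠ 0 := by
    rintro rfl
    simp at hy₁
  let O : Set (Fin m → ℝ) := {y | y ≠ 0} ∩ ν ⁻¹' V
  have hne : {y : Fin m → ℝ | y ≠ 0} ∈ 𝓝 y₁ := isOpen_ne.mem_nhds hy0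
  have hO : O ∈ 𝓝 y₁ := by
    refine Filter.inter_mem hne ((hν0.continuousAt hne).preimage_mem_nhds ?_)
    rwa [hνid hy₁]
  have hOW : ∀ y ∈ O, h₁ (ν y) ∈ W := fun y hy => hVW ⟨hy.2, by simpa using hν1 hy.1⟩
  -- `φ` transfers boundary points of the first ball to the second one.
  let φ : (Fin m → ℝ) → Fin m → ℝ := fun y => g (h₁ (ν y))
  have hφ : ∀ y ∈ O, ‖φ y‖ = 1 ∧ h₂ (φ y) = h₁ (ν y) := by
    intro y hy
    obtain ⟨z, hz, hzy⟩ := hW₂ (hOW y hy)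
    have h1 : φ y = z := by
      change g (h₁ (ν y)) = z
      rw [← hzy, hgh z (sphere_subset_closedBall hz)]
    rw [h1]
    exact ⟨by simpa using hz, hzy⟩
  have hφc : ContinuousOn φ O := by
    refine hg.comp (hc₁.comp (hν0.mono inter_subset_left) fun y hy => hmem (hν1 hy.1).le) ?_
    intro y hy
    exact image_mono sphere_subset_closedBall (hW₂ (hOW y hy))
  have hinv : ∀ y ∈ O, ‖‖y‖⁻¹ • φ y‖ = ‖y‖⁻¹ := fun y hy => by
    rw [norm_smul, (hφ y hy).1, mul_one, norm_inv, norm_norm]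
  let Θ : (Fin m → ℝ) → Fin (m + 1) → ℝ := fun y =>
    if ‖y‖ ≤ 1 then h₁ y else h₂ (‖y‖⁻¹ • φ y)
  have hΘ : ContinuousOn Θ O := by
    refine ContinuousOn.if ?_ ?_ ?_
    · rintro y ⟨hy, hyf⟩
      have h1 : ‖y‖ = 1 := frontier_le_subset_eq continuous_norm continuous_const hyf
      rw [h1, inv_one, one_smul, (hφ y hy).2, hνid h1]
    · refine hc₁.mono ?_
      rintro y ⟨-, hy⟩
      rw [(isClosed_le continuous_norm continuous_const).closure_eq] at hy
      exact hmem hy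
    · have hsub : closure {y : Fin m → ℝ | ¬ ‖y‖ ≤ 1} ⊆ {y | 1 ≤ ‖y‖} := by
        simp only [not_le]
        exact closure_lt_subset_le continuous_const continuous_norm
      have h1 : ContinuousOn (fun y : Fin m → ℝ => ‖y‖⁻¹ • φ y) O :=
        (continuous_norm.continuousOn.inv₀ fun y hy => norm_ne_zero_iff.2 hy.1).smul hφc
      refine hc₂.comp (h1.mono inter_subset_left) ?_
      rintro y ⟨hy, hyc⟩
      apply hmem
      rw [hinv y hy]
      exact inv_le_one_of_one_le₀ (hsub hyc)
  have hlt : ∀ {y : Fin m → ℝ}, y ∈ O → ¬ ‖y‖ ≤ 1 → ‖‖y‖⁻¹ • φ y‖ < 1 := fun {y} hy h => by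
    rw [hinv y hy]
    exact inv_lt_one_of_one_lt₀ (not_le.1 h)
  have hmixed : ∀ {y z : Fin m → ℝ}, y ∈ O → z ∈ O → ‖y‖ ≤ 1 → ¬ ‖z‖ ≤ 1 →
      h₁ y ≠ h₂ (‖z‖⁻¹ • φ z) := by
    intro y z hy hz hy1 hz1 heq
    rcases hy1.eq_or_lt with h | h
    · have := hOW y hy
      rw [hνid h, heq] at this
      exact hdW _ (hlt hz hz1) this
    · exact hd _ _ h (hlt hz hz1) heq
  have hΘi : InjOn Θ O := by
    intro y hy z hz hyz
    by_cases hy1 : ‖y‖ ≤ 1 <;> by_cases hz1 : ‖z‖ ≤ 1 <;>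
      simp only [Θ, hy1, hz1, if_true, if_false] at hyz
    · exact hi₁ (hmem hy1) (hmem hz1) hyz
    · exact absurd hyz (hmixed hy hz hy1 hz1)
    · exact absurd hyz.symm (hmixed hz hy hz1 hy1)
    · have h1 := hi₂ (hmem (hlt hy hy1).le) (hmem (hlt hz hz1).le) hyz
      have h2 : ‖y‖ = ‖z‖ := by
        have := congrArg norm h1
        rwa [hinv y hy, hinv z hz, inv_inj] at this
      have h3 : ‖z‖⁻¹ ≠ 0 := inv_ne_zero (norm_ne_zero_iff.2 hz.1)
      rw [h2] at h1
      have h4 : h₁ (ν y) = h₁ (ν z) := by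
        rw [← (hφ y hy).2, ← (hφ z hz).2, smul_right_injective _ h3 h1]
      have h5 := hi₁ (hmem (hν1 hy.1).le) (hmem (hν1 hz.1).le) h4
      simp only [ν, h2] at h5
      exact smul_right_injective _ h3 h5
  have hΘ1 : ∀ y ∈ O, ‖Θ y‖ = 1 := by
    intro y hy
    by_cases hy1 : ‖y‖ ≤ 1
    · simp only [Θ, hy1, if_true, hn₁ y hy1]
    · simp only [Θ, hy1, if_false, hn₂ _ (hlt hy hy1).le]
  have h := image_mem_nhdsWithin_sphere hO hΘ hΘi hΘ1
  have hΘy : Θ y₁ = h₁ y₁ := if_pos hy₁.le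
  rw [hΘy] at h
  refine Filter.mem_of_superset h ?_
  rintro _ ⟨y, hy, rfl⟩
  by_cases hy1 : ‖y‖ ≤ 1
  · left
    simp only [Θ, hy1, if_true]
    exact ⟨y, hmem hy1, rfl⟩
  · right
    simp only [Θ, hy1, if_false]
    exact ⟨_, hmem (hlt hy hy1).le, rfl⟩

end Doubling

/-- An interval is connected if no property that passes to comparable elements splits it. -/
theorem isConnectedInterval_of_forall {P : Type*} [PartialOrder P] {u v : P}
    (hne : (Ioo u v).Nonempty)
    (h : ∀ p : P → Prop, (∀ a ∈ Ioo u v, ∀ b ∈ Ioo u v, a < b → (p a ↔ p b)) →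
      ∀ a ∈ Ioo u v, ∀ b ∈ Ioo u v, p a → p b) : IsConnectedInterval u v := by
  have : Nonempty (Ioo u v) := hne.to_subtype
  refine ⟨fun a b => ?_⟩
  have key := h (fun c => ∃ hc : c ∈ Ioo u v,
    (SimpleGraph.fromRel fun a b : Ioo u v => a < b).Reachable a ⟨c, hc⟩) ?_ a a.2 b b.2
    ⟨a.2, SimpleGraph.Reachable.refl _⟩
  · obtain ⟨_, hb⟩ := key
    exact hb
  · intro c hc d hd hcd
    have hadj : (SimpleGraph.fromRel fun a b : Ioo u v => a < b).Adj ⟨c, hc⟩ ⟨d, hd⟩ :=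
      (SimpleGraph.fromRel_adj _ _ _).2 ⟨fun h => hcd.ne (congrArg Subtype.val h), Or.inl hcd⟩
    exact ⟨fun ⟨_, h⟩ => ⟨hd, h.trans hadj.reachable⟩,
      fun ⟨_, h⟩ => ⟨hc, h.trans hadj.symm.reachable⟩⟩

variable {X : Type*} [TopologicalSpace X] {C : Set X} [CWComplex C]

theorem IsRegular.closedCell_eq (h : IsRegular C) (e : Cell C) :
    ∃ S : Set (Cell C), e.closedCell = ⋃ s ∈ S, s.openCell := by
  obtain ⟨-, S, -, -, hS⟩ := h e
  refine ⟨insert e S, ?_⟩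
  rw [biUnion_insert, ← hS, union_comm]
  exact (RelCWComplex.cellFrontier_union_openCell_eq_closedCell e.dim e.idx).symm

theorem IsRegular.injOn_charMap (h : IsRegular C) (e : Cell C) :
    InjOn e.charMap (closedBall 0 1) :=
  Cell.injOn_charMap_of_sphere (injOn_iff_injective.2 (h e).1.injective)

variable [T2Space X]

namespace Cell

/-- A point of the ball of `e` lying over the open cell `s` has a neighbourhood that meets only
preimages of cells above `s`. -/
theorem eventually_le [CWComplex.Finite C] (hn : IsNormal C) {e s : Cell C} {x : Fin e.dim → ℝ}
    (hx : ‖x‖ ≤ 1) (hxs : e.charMap x ∈ s.openCell) :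
    ∀ᶠ y in 𝓝[closedBall 0 1] x, ∀ t : Cell C, e.charMap y ∈ t.openCell → s ≤ t := by
  have hclosed : IsClosed (⋃ t ∈ {t : Cell C | ¬ s ≤ t}, t.closedCell) :=
    (Set.toFinite _).isClosed_biUnion fun t _ => t.isClosed_closedCell
  have hmem : e.charMap x ∉ ⋃ t ∈ {t : Cell C | ¬ s ≤ t}, t.closedCell := by
    simp only [mem_iUnion]
    rintro ⟨t, ht, hxt⟩
    exact ht (hn s t _ hxs hxt)
  have hc := e.continuousOn_charMap x (by simpa using hx)
  filter_upwards [hc.eventually (hclosed.isOpen_compl.mem_nhds hmem)] with y hy t ht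
  by_contra hcon
  exact hy (mem_biUnion (show t ∈ {t : Cell C | ¬ s ≤ t} from hcon)
    (subset_closure.trans_eq t.closure_openCell ht))

/-- Invariance of dimension: if the characteristic map of `e` is injective on the boundary sphere,
then the cells of codimension one are dense in this sphere. A cell of largest dimension among those
that meet a given open set of the sphere contains a smaller open set. -/
theorem sphere_subset_closure_codimOnePreimage [CWComplex.Finite C] (hn : IsNormal C) {e : Cell C}
    (he : InjOn e.charMap (closedBall 0 1)) : sphere 0 1 ⊆ closure e.codimOnePreimage := by
  intro x hx
  by_contra hcl
  let T : Set (Fin e.dim → ℝ) := (closure e.codimOnePreimage)ᶜ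
  have hT : IsOpen T := isClosed_closure.isOpen_compl
  let J : Set (Cell C) := {s | s.dim < e.dim ∧ ∃ y ∈ T, ‖y‖ = 1 ∧ e.charMap y ∈ s.openCell}
  have hJ : J.Nonempty := by
    have hx1 : ‖x‖ = 1 := by simpa using hx
    obtain ⟨s, hs, hxs⟩ := e.exists_mem_openCell_of_norm_eq_one hx1
    exact ⟨s, hs, x, hcl, hx1, hxs⟩
  obtain ⟨s, ⟨hsd, y, hyT, hy, hys⟩, hmax⟩ :=
    Set.exists_max_image J (fun s => s.dim) (Set.toFinite J) hJ
  have hsd' : s.dim + 1 ≠ e.dim := fun h =>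
    hyT (subset_closure ⟨by simpa using hy.le, s, h, hys⟩)
  have hev : ∀ᶠ z in 𝓝[sphere 0 1] y, z ∈ T ∧ ∀ t : Cell C, e.charMap z ∈ t.openCell → s ≤ t :=
    Filter.Eventually.and (mem_nhdsWithin_of_mem_nhds (hT.mem_nhds hyT))
      ((eventually_le hn hy.le hys).filter_mono (nhdsWithin_mono _ sphere_subset_closedBall))
  set V : Set (Fin e.dim → ℝ) := {z | z ∈ T ∧ ∀ t : Cell C, e.charMap z ∈ t.openCell → s ≤ t}
  have hV : MapsTo e.charMap (V ∩ sphere 0 1) s.openCell := by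
    rintro z ⟨⟨hzT, hz⟩, hz1⟩
    have hz1' : ‖z‖ = 1 := by simpa using hz1
    obtain ⟨t, htd, hzt⟩ := e.exists_mem_openCell_of_norm_eq_one hz1'
    have h1 := hmax t ⟨htd, z, hzT, hz1', hzt⟩
    rcases eq_or_dim_lt (hz t hzt) with h | h
    · rwa [h]
    · omega
  obtain ⟨g, hg, hgs⟩ := s.exists_continuousOn_inverse
  have hgi : InjOn g s.openCell := by
    rintro _ ⟨a, ha, rfl⟩ _ ⟨b, hb, rfl⟩ hab
    have : g (s.charMap a) = g (s.charMap b) := hab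
    rw [hgs a ha, hgs b hb] at this
    rw [this]
  have hsub : V ∩ sphere 0 1 ⊆ closedBall 0 1 := inter_subset_right.trans sphere_subset_closedBall
  have hgc : ContinuousOn (g ∘ e.charMap) (V ∩ sphere 0 1) :=
    hg.comp (e.continuousOn_charMap.mono hsub) hV
  have hgci : InjOn (g ∘ e.charMap) (V ∩ sphere 0 1) := hgi.comp (he.mono hsub) hV
  exact not_injOn_of_sphere (by omega) hy hev hgc hgci

end Cell

end FiniteCW

/-! ### The closure poset of a regular complex -/

namespace FiniteCW

variable {X : Type*} [TopologicalSpace X] [T2Space X] {C : Set X} [CWComplex C]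

namespace Cell

theorem exists_norm_eq_one_of_lt {s e : Cell C} (h : s < e) {p : X} (hp : p ∈ s.openCell) :
    ∃ x, ‖x‖ = 1 ∧ e.charMap x = p := by
  obtain ⟨x, hx, rfl⟩ := le_iff.1 h.le hp
  exact ⟨x, e.norm_eq_one_of_mem (by simpa using hx) hp h.ne, rfl⟩

/-- As the facets are dense in the boundary, every boundary cell lies below one. -/
theorem exists_facet_of_norm_eq_one [CWComplex.Finite C] (hn : IsNormal C) {e s : Cell C}
    (he : InjOn e.charMap (closedBall 0 1)) {x : Fin e.dim → ℝ} (hx : ‖x‖ = 1)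
    (hxs : e.charMap x ∈ s.openCell) : ∃ r, s ≤ r ∧ r < e ∧ r.dim + 1 = e.dim := by
  have hcl := sphere_subset_closure_codimOnePreimage hn he (by simpa using hx)
  have hcl' : (𝓝[e.codimOnePreimage] x).NeBot := mem_closure_iff_nhdsWithin_neBot.1 hcl
  obtain ⟨y, hy, hyB, r, hr, hyr⟩ := (((eventually_le hn hx.le hxs).filter_mono
    (nhdsWithin_mono _ fun y (hy : y ∈ e.codimOnePreimage) => hy.1)).and
      self_mem_nhdsWithin).exists
  exact ⟨r, hy r hyr, lt_of_le_of_dim_lt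
    (hn r e _ hyr (e.charMap_mem_closedCell (by simpa using hyB))) (by omega), hr⟩

theorem exists_facet [CWComplex.Finite C] (hn : IsNormal C) {e s : Cell C}
    (he : InjOn e.charMap (closedBall 0 1)) (h : s < e) :
    ∃ r, s ≤ r ∧ r < e ∧ r.dim + 1 = e.dim := by
  obtain ⟨p, hp⟩ := s.openCell_nonempty
  obtain ⟨x, hx, rfl⟩ := exists_norm_eq_one_of_lt h hp
  exact exists_facet_of_norm_eq_one hn he hx hp

theorem exists_lt_of_dim_pos [CWComplex.Finite C] (hn : IsNormal C) {e : Cell C}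
    (he : InjOn e.charMap (closedBall 0 1)) (h : 0 < e.dim) : ∃ r, r < e ∧ r.dim + 1 = e.dim := by
  have : NeZero e.dim := ⟨h.ne'⟩
  have hx : ‖(Pi.single 0 1 : Fin e.dim → ℝ)‖ = 1 := by simp [Pi.norm_single]
  obtain ⟨s, -, hs⟩ := e.exists_mem_openCell_of_norm_eq_one hx
  obtain ⟨r, -, hr⟩ := exists_facet_of_norm_eq_one hn he hx hs
  exact ⟨r, hr⟩

/-- Injective characteristic maps are embeddings, so lifts are obtained by inverting them. -/
theorem exists_isLift {s e : Cell C} (hs : InjOn s.charMap (closedBall 0 1))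
    (he : InjOn e.charMap (closedBall 0 1)) (h : s ≤ e) : ∃ ι, IsLift s e ι := by
  obtain ⟨g, hg, hge⟩ := exists_continuousOn_leftInverse (isCompact_closedBall 0 1)
    e.continuousOn_charMap he
  have key : ∀ x, ‖x‖ ≤ 1 → ‖g (s.charMap x)‖ ≤ 1 ∧ e.charMap (g (s.charMap x)) = s.charMap x := by
    intro x hx
    obtain ⟨y, hy, hyx⟩ := closedCell_subset h (s.charMap_mem_closedCell hx)
    change e.charMap y = _ at hyx
    rw [← hyx, hge y hy]
    exact ⟨by simpa using hy, rfl⟩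
  refine ⟨fun x => g (s.charMap x), hg.comp s.continuousOn_charMap fun x hx => ?_, ?_,
    fun x hx => (key x hx).1, fun x hx => (key x hx).2⟩
  · exact closedCell_subset h (s.charMap_mem_closedCell (by simpa using hx))
  · intro x hx y hy hxy
    apply hs hx hy
    rw [← (key x (by simpa using hx)).2, ← (key y (by simpa using hy)).2]
    exact congrArg e.charMap hxy

/-- The preimage of a closed boundary cell lies in the closure of that of the open cell. -/
theorem mem_closure_of_mem_closedCell {t e : Cell C} (ht : InjOn t.charMap (closedBall 0 1))
    (he : InjOn e.charMap (closedBall 0 1)) (h : t < e) {x : Fin e.dim → ℝ} (hx : ‖x‖ ≤ 1)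
    (hxt : e.charMap x ∈ t.closedCell) : x ∈ closure {y | ‖y‖ = 1 ∧ e.charMap y ∈ t.openCell} := by
  obtain ⟨ι, hι⟩ := exists_isLift ht he h.le
  obtain ⟨z, hz, hzx⟩ := hxt
  have hz1 : ‖z‖ ≤ 1 := by simpa using hz
  have hιz : ι z = x := he (by simpa using hι.norm_le z hz1) (by simpa using hx)
    ((hι.charMap z hz1).trans hzx)
  have hc : ContinuousOn ι (closure (ball 0 1)) := by
    rw [closure_ball _ one_ne_zero]
    exact hι.continuousOn
  have h1 : ι z ∈ ι '' closure (ball 0 1) :=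
    mem_image_of_mem _ (by rwa [closure_ball _ one_ne_zero])
  rw [← hιz]
  refine closure_mono ?_ (hc.image_closure h1)
  rintro _ ⟨w, hw, rfl⟩
  have hw1 : ‖w‖ < 1 := by simpa using hw
  have hιw : e.charMap (ι w) ∈ t.openCell := by
    rw [hι.charMap w hw1.le]
    exact t.charMap_mem_openCell hw1
  exact ⟨e.norm_eq_one_of_mem (hι.norm_le w hw1.le) hιw h.ne, hιw⟩

/-- A cell of codimension two is not covered by only one facet, for then this facet would cover a
neighbourhood of a point of its own boundary in the boundary sphere of `e`. -/
theorem exists_facet_ne [CWComplex.Finite C] (hn : IsNormal C)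
    (hinj : ∀ e : Cell C, InjOn e.charMap (closedBall 0 1)) {s r e : Cell C}
    (hsr : s < r) (hre : r < e) (hd : s.dim + 2 = e.dim) :
    ∃ r', r' ≠ r ∧ s < r' ∧ r' < e := by
  by_contra! hcon
  have hd1 := dim_lt_of_lt hsr
  have hd2 := dim_lt_of_lt hre
  obtain ⟨ι, hι⟩ := exists_isLift (hinj r) (hinj e) hre.le
  obtain ⟨p, hp⟩ := s.openCell_nonempty
  obtain ⟨y, hy, rfl⟩ := exists_norm_eq_one_of_lt hsr hp
  have hιy : e.charMap (ι y) ∈ s.openCell := by rwa [hι.charMap y hy.le]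
  have hιy1 : ‖ι y‖ = 1 :=
    e.norm_eq_one_of_mem (hι.norm_le y hy.le) hιy (hsr.trans hre).ne
  refine not_subset_image_closedBall_of_sphere (by omega) hι.continuousOn hι.injOn hy hιy1
    ((eventually_le hn hιy1.le hιy).filter_mono (nhdsWithin_mono _ sphere_subset_closedBall)) ?_
  rintro x ⟨hx, hx1⟩
  have hx1' : ‖x‖ = 1 := by simpa using hx1
  obtain ⟨t, htd, hxt⟩ := e.exists_mem_openCell_of_norm_eq_one hx1'
  have hst : s ≤ t := hx t hxt
  have hte : t < e := lt_of_le_of_dim_lt (hn t e _ hxt (e.charMap_mem_closedCell hx1'.le)) htd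
  have htr : t ≤ r := by
    rcases hst.eq_or_lt with rfl | h
    · exact hsr.le
    · by_contra hne
      exact hcon t (fun h' => hne h'.le) h hte
  obtain ⟨z, hz, hzx⟩ := le_iff.1 htr hxt
  have hz1 : ‖z‖ ≤ 1 := by simpa using hz
  exact ⟨z, hz, hinj e (by simpa using hι.norm_le z hz1) (sphere_subset_closedBall hx1)
    ((hι.charMap z hz1).trans hzx)⟩

/-- A cell of codimension two is not covered by three facets, for two of them cover a neighbourhood
of its points in the boundary sphere of `e`. -/
theorem facet_eq_or_eq [CWComplex.Finite C] (hn : IsNormal C)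
    (hinj : ∀ e : Cell C, InjOn e.charMap (closedBall 0 1)) {s r₁ r₂ t e : Cell C}
    (hd : s.dim + 2 = e.dim) (hs₁ : s < r₁) (he₁ : r₁ < e) (hs₂ : s < r₂) (he₂ : r₂ < e)
    (hst : s < t) (hte : t < e) (h₁₂ : r₁ ≠ r₂) : t = r₁ ∨ t = r₂ := by
  by_contra! hcon
  have hds₁ := dim_lt_of_lt hs₁
  have hds₂ := dim_lt_of_lt hs₂
  have hdst := dim_lt_of_lt hst
  have hde₁ := dim_lt_of_lt he₁
  have hde₂ := dim_lt_of_lt he₂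
  have hdte := dim_lt_of_lt hte
  obtain ⟨h₁, hl₁⟩ := exists_isLift (hinj r₁) (hinj e) he₁.le
  obtain ⟨h₂, hl₂⟩ := exists_isLift (hinj r₂) (hinj e) he₂.le
  obtain ⟨p, hp⟩ := s.openCell_nonempty
  obtain ⟨y, hy, rfl⟩ := exists_norm_eq_one_of_lt hs₁ hp
  have hn₁ : ∀ y, ‖y‖ ≤ 1 → ‖h₁ y‖ = 1 := by
    intro y hy
    obtain ⟨w, hw, hyw⟩ := r₁.exists_mem_openCell hy
    refine e.norm_eq_one_of_mem (hl₁.norm_le y hy) (s := w) (by rwa [hl₁.charMap y hy]) ?_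
    rintro rfl; omega
  have hn₂ : ∀ y, ‖y‖ ≤ 1 → ‖h₂ y‖ = 1 := by
    intro y hy
    obtain ⟨w, hw, hyw⟩ := r₂.exists_mem_openCell hy
    refine e.norm_eq_one_of_mem (hl₂.norm_le y hy) (s := w) (by rwa [hl₂.charMap y hy]) ?_
    rintro rfl; omega
  let W : Set (Fin e.dim → ℝ) := {x | ‖x‖ = 1 ∧ e.charMap x ∈ s.openCell}
  have hW₁ : ∀ᶠ z in 𝓝[sphere 0 1] y, h₁ z ∈ W := by
    filter_upwards [(eventually_le hn hy.le hp).filter_mono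
      (nhdsWithin_mono _ sphere_subset_closedBall), self_mem_nhdsWithin] with z hz hz1
    have hz1' : ‖z‖ = 1 := by simpa using hz1
    obtain ⟨w, hwd, hzw⟩ := r₁.exists_mem_openCell_of_norm_eq_one hz1'
    have hws : s = w := (eq_or_dim_lt (hz w hzw)).resolve_right (by omega)
    refine ⟨hn₁ z hz1'.le, ?_⟩
    rw [hl₁.charMap z hz1'.le, hws]
    exact hzw
  have hW₂ : W ⊆ h₂ '' sphere 0 1 := by
    rintro x ⟨hx, hxs⟩
    obtain ⟨z, hz, hzx⟩ := exists_norm_eq_one_of_lt hs₂ hxs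
    exact ⟨z, by simpa using hz, hinj e (by simpa using hl₂.norm_le z hz.le) (by simpa using hx.le)
      ((hl₂.charMap z hz.le).trans hzx)⟩
  -- The two lifts cover a neighbourhood, which the third cell meets.
  have hnhds := image_union_image_mem_nhdsWithin (by omega) (by omega) hl₁.continuousOn
    hl₂.continuousOn
    hl₁.injOn hl₂.injOn hn₁ hn₂ hy hW₁ hW₂ (by
      intro a b ha hb hab
      apply h₁₂
      have e1 := r₁.charMap_mem_openCell ha
      have e2 := r₂.charMap_mem_openCell hb
      rw [← hl₁.charMap a ha.le, hab, hl₂.charMap b hb.le] at e1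
      exact eq_of_mem e1 e2) (by
      rintro b hb ⟨-, hbs⟩
      rw [hl₂.charMap b hb.le] at hbs
      exact hs₂.ne (eq_of_mem hbs (r₂.charMap_mem_openCell hb)))
  have hcl : h₁ y ∈ closure {x | ‖x‖ = 1 ∧ e.charMap x ∈ t.openCell} :=
    mem_closure_of_mem_closedCell (hinj t) (hinj e) hte (hn₁ y hy.le).le (by
      rw [hl₁.charMap y hy.le]
      exact le_iff.1 hst.le hp)
  have hcl' := mem_closure_iff_nhdsWithin_neBot.1 hcl
  obtain ⟨x, hx, -, hxt⟩ := ((Filter.Eventually.filter_mono (nhdsWithin_mono _ fun x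
    (hx : x ∈ {x : Fin e.dim → ℝ | ‖x‖ = 1 ∧ e.charMap x ∈ t.openCell}) =>
      (by simpa using hx.1 : x ∈ sphere (0 : Fin e.dim → ℝ) 1)) hnhds).and
    self_mem_nhdsWithin).exists
  rcases hx with ⟨z, hz, rfl⟩ | ⟨z, hz, rfl⟩
  · have hz1 : ‖z‖ ≤ 1 := by simpa using hz
    have hle := hn t r₁ _ hxt (by rw [hl₁.charMap z hz1]; exact r₁.charMap_mem_closedCell hz1)
    exact hcon.1 ((eq_or_dim_lt hle).resolve_right (by omega))
  · have hz1 : ‖z‖ ≤ 1 := by simpa using hz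
    have hle := hn t r₂ _ hxt (by rw [hl₂.charMap z hz1]; exact r₂.charMap_mem_closedCell hz1)
    exact hcon.2 ((eq_or_dim_lt hle).resolve_right (by omega))

/-- If a preconnected set `Y` is covered by open cells from a set `I`, then `Y` cannot be split
along a property that passes to comparable cells of `I`. -/
theorem of_isPreconnected [CWComplex.Finite C] (hn : IsNormal C) {Y : Set X}
    (hY : IsPreconnected Y) {I : Set (Cell C)} (hYI : ∀ y ∈ Y, ∃ w ∈ I, y ∈ w.openCell)
    {p : Cell C → Prop} (hp : ∀ s ∈ I, ∀ t ∈ I, s < t → (p s ↔ p t)) {a b : Cell C}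
    (ha : a ∈ I) (hb : b ∈ I) (hYa : (Y ∩ a.openCell).Nonempty) (hYb : (Y ∩ b.openCell).Nonempty)
    (hpa : p a) : p b := by
  by_contra hpb
  have hclosed : ∀ J : Set (Cell C), IsClosed (⋃ t ∈ J, t.closedCell) := fun J =>
    (Set.toFinite J).isClosed_biUnion fun t _ => t.isClosed_closedCell
  have hsub : ∀ t : Cell C, t.openCell ⊆ t.closedCell := fun t =>
    subset_closure.trans_eq t.closure_openCell
  have hp' : ∀ s ∈ I, ∀ t ∈ I, s ≤ t → (p s ↔ p t) := by
    intro s hs t ht hst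
    rcases hst.eq_or_lt with rfl | h
    · exact Iff.rfl
    · exact hp s hs t ht h
  obtain ⟨y, hyY, hy1, hy2⟩ := isPreconnected_closed_iff.1 hY
    (⋃ t ∈ {t | t ∈ I ∧ p t}, t.closedCell) (⋃ t ∈ {t | t ∈ I ∧ ¬ p t}, t.closedCell)
    (hclosed _) (hclosed _) (by
      intro y hy
      obtain ⟨w, hw, hyw⟩ := hYI y hy
      by_cases h : p w
      · exact Or.inl (mem_biUnion (show w ∈ {t | t ∈ I ∧ p t} from ⟨hw, h⟩) (hsub w hyw))
      · exact Or.inr (mem_biUnion (show w ∈ {t | t ∈ I ∧ ¬ p t} from ⟨hw, h⟩) (hsub w hyw)))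
    (by
      obtain ⟨y, hy, hya⟩ := hYa
      exact ⟨y, hy, mem_biUnion (show a ∈ {t | t ∈ I ∧ p t} from ⟨ha, hpa⟩) (hsub a hya)⟩)
    (by
      obtain ⟨y, hy, hyb⟩ := hYb
      exact ⟨y, hy, mem_biUnion (show b ∈ {t | t ∈ I ∧ ¬ p t} from ⟨hb, hpb⟩) (hsub b hyb)⟩)
  obtain ⟨w, hw, hyw⟩ := hYI y hyY
  simp only [mem_iUnion] at hy1 hy2
  obtain ⟨t, ⟨ht, hpt⟩, hyt⟩ := hy1
  obtain ⟨t', ⟨ht', hpt'⟩, hyt'⟩ := hy2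
  exact hpt' ((hp' w hw t' ht' (hn w t' y hyw hyt')).1
    ((hp' w hw t ht (hn w t y hyw hyt)).2 hpt))

/-- The boundary of a cell `e` of dimension at least two is connected, so a property that passes to
comparable cells below `e` holds for all of them if it holds for one. -/
theorem of_compat_lt [CWComplex.Finite C] (hn : IsNormal C) {e : Cell C} (hd : 2 ≤ e.dim)
    {p : Cell C → Prop} (hp : ∀ s, s < e → ∀ t, t < e → s < t → (p s ↔ p t)) {a b : Cell C}
    (ha : a < e) (hb : b < e) (hpa : p a) : p b := by
  have hrank : 1 < Module.rank ℝ (Fin e.dim → ℝ) := by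
    rw [rank_fin_fun]
    exact_mod_cast hd
  have hY : IsPreconnected (e.charMap '' sphere 0 1) :=
    (isPreconnected_sphere hrank 0 1).image _
      (e.continuousOn_charMap.mono sphere_subset_closedBall)
  have hne : ∀ c : Cell C, c < e → (e.charMap '' sphere 0 1 ∩ c.openCell).Nonempty := by
    intro c hc
    obtain ⟨q, hq⟩ := c.openCell_nonempty
    obtain ⟨x, hx, rfl⟩ := exists_norm_eq_one_of_lt hc hq
    exact ⟨_, ⟨x, by simpa using hx, rfl⟩, hq⟩
  refine of_isPreconnected hn hY (I := {w | w < e}) ?_ hp ha hb (hne a ha) (hne b hb) hpa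
  rintro _ ⟨x, hx, rfl⟩
  have hx1 : ‖x‖ = 1 := by simpa using hx
  obtain ⟨t, htd, hxt⟩ := e.exists_mem_openCell_of_norm_eq_one hx1
  exact ⟨t, lt_of_le_of_dim_lt (hn t e _ hxt (e.charMap_mem_closedCell hx1.le)) htd, hxt⟩

/-- Near a point of a cell `s` of codimension at least three, the boundary sphere of `e` remains
connected when `s` is removed, so a property that passes to comparable cells strictly between `s`
and `e` holds for all of them if it holds for one. -/
theorem of_compat_Ioo [CWComplex.Finite C] (hn : IsNormal C)
    (hinj : ∀ e : Cell C, InjOn e.charMap (closedBall 0 1)) {s e : Cell C}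
    (hse : s < e) (hd : s.dim + 3 ≤ e.dim) {p : Cell C → Prop}
    (hp : ∀ w ∈ Ioo s e, ∀ t ∈ Ioo s e, w < t → (p w ↔ p t)) {a b : Cell C}
    (ha : a ∈ Ioo s e) (hb : b ∈ Ioo s e) (hpa : p a) : p b := by
  obtain ⟨q, hq⟩ := s.openCell_nonempty
  obtain ⟨x, hx, rfl⟩ := exists_norm_eq_one_of_lt hse hq
  obtain ⟨g, hg, hgs⟩ := s.exists_continuousOn_inverse
  have hgi : InjOn g s.openCell := by
    rintro _ ⟨a, ha, rfl⟩ _ ⟨b, hb, rfl⟩ hab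
    have : g (s.charMap a) = g (s.charMap b) := hab
    rw [hgs a ha, hgs b hb] at this
    rw [this]
  let F : Set (Fin e.dim → ℝ) := closedBall 0 1 ∩ e.charMap ⁻¹' s.closedCell
  have hF : IsClosed F :=
    e.continuousOn_charMap.preimage_isClosed_of_isClosed isClosed_closedBall s.isClosed_closedCell
  let T : Set (Fin e.dim → ℝ) := {y | ∀ t : Cell C, e.charMap y ∈ t.openCell → s ≤ t}
  have hT : T ∈ 𝓝[sphere 0 1] x := (eventually_le hn hx.le hq).filter_mono
    (nhdsWithin_mono _ sphere_subset_closedBall)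
  -- In this neighbourhood the closed cell of `s` is just the open cell.
  have hmaps : MapsTo e.charMap (T ∩ sphere 0 1 ∩ F) s.openCell := by
    rintro y ⟨⟨hyT, hy⟩, hyF⟩
    obtain ⟨t, -, hyt⟩ := e.exists_mem_openCell_of_norm_eq_one (by simpa using hy)
    rwa [le_antisymm (hyT t hyt) (hn t s _ hyt hyF.2)]
  have hsubB : T ∩ sphere 0 1 ∩ F ⊆ closedBall 0 1 := fun y hy => hy.2.1
  obtain ⟨Y, hYT, hYx, hYc⟩ := exists_isPreconnected_diff_of_sphere hd hx hT hF
    (hg.comp (e.continuousOn_charMap.mono hsubB) hmaps)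
    (hgi.comp ((hinj e).mono hsubB) hmaps)
  have hYc' : IsPreconnected (e.charMap '' (Y \ F)) := hYc.image _
    (e.continuousOn_charMap.mono fun y hy => sphere_subset_closedBall (hYT hy.1).2)
  have hne : ∀ c ∈ Ioo s e, (e.charMap '' (Y \ F) ∩ c.openCell).Nonempty := by
    rintro c ⟨hsc, hce⟩
    have hcl := mem_closure_of_mem_closedCell (hinj c) (hinj e) hce hx.le (le_iff.1 hsc.le hq)
    have hcl' := mem_closure_iff_nhdsWithin_neBot.1 hcl
    obtain ⟨y, hyY, -, hyc⟩ := ((Filter.Eventually.filter_mono (nhdsWithin_mono _ fun x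
      (hx : x ∈ {x : Fin e.dim → ℝ | ‖x‖ = 1 ∧ e.charMap x ∈ c.openCell}) =>
        (by simpa using hx.1 : x ∈ sphere (0 : Fin e.dim → ℝ) 1)) hYx).and
      self_mem_nhdsWithin).exists
    exact ⟨_, ⟨y, ⟨hyY, fun hyF => (hn c s _ hyc hyF.2).not_gt hsc⟩, rfl⟩, hyc⟩
  refine of_isPreconnected hn hYc' (I := Ioo s e) ?_ hp ha hb (hne a ha) (hne b hb) hpa
  rintro _ ⟨y, ⟨hyY, hyF⟩, rfl⟩
  obtain ⟨hyT, hy⟩ := hYT hyY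
  have hy1 : ‖y‖ = 1 := by simpa using hy
  obtain ⟨t, htd, hyt⟩ := e.exists_mem_openCell_of_norm_eq_one hy1
  refine ⟨t, ⟨lt_of_le_of_ne (hyT t hyt) ?_, lt_of_le_of_dim_lt
    (hn t e _ hyt (e.charMap_mem_closedCell hy1.le)) htd⟩, hyt⟩
  rintro rfl
  exact hyF ⟨sphere_subset_closedBall hy, subset_closure.trans_eq s.closure_openCell hyt⟩

end Cell

section ClosurePoset

/-- The boundary of a one-dimensional cell consists of two vertices. -/
theorem exists_Iio_eq_pair (hn : IsNormal C) {e : Cell C}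
    (hinj : InjOn e.charMap (closedBall 0 1)) (hd : e.dim = 1) :
    ∃ r r', r ≠ r' ∧ Iio e = {r, r'} := by
  have h1 : ∀ c : ℝ, |c| = 1 → ‖(fun _ => c : Fin e.dim → ℝ)‖ = 1 := by
    intro c hc
    have : Nonempty (Fin e.dim) := ⟨⟨0, by omega⟩⟩
    rw [pi_norm_const, Real.norm_eq_abs, hc]
  have hp := h1 1 (by simp)
  have hm := h1 (-1) (by simp)
  obtain ⟨r, hrd, hr⟩ := e.exists_mem_openCell_of_norm_eq_one hp
  obtain ⟨r', hrd', hr'⟩ := e.exists_mem_openCell_of_norm_eq_one hm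
  have hlt : ∀ {t : Cell C} {x : Fin e.dim → ℝ}, ‖x‖ = 1 → e.charMap x ∈ t.openCell → t ≠ e →
      t < e := fun {t x} hx hxt hne =>
    lt_of_le_of_ne (hn t e _ hxt (e.charMap_mem_closedCell hx.le)) hne
  have hsing : ∀ t : Cell C, t.dim = 0 → ∀ p ∈ t.openCell, ∀ q ∈ t.openCell, p = q := by
    rintro ⟨n, i⟩ h p ⟨x, -, rfl⟩ q ⟨y, -, rfl⟩
    obtain rfl : n = 0 := h
    rw [Subsingleton.elim x y]
  refine ⟨r, r', ?_, ?_⟩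
  · rintro rfl
    have h2 := hinj (by simpa using hp.le) (by simpa using hm.le) (hsing r (by omega) _ hr _ hr')
    have := congrFun h2 ⟨0, by omega⟩
    norm_num at this
  · ext t
    simp only [mem_Iio, mem_insert_iff, mem_singleton_iff]
    constructor
    · intro hte
      obtain ⟨q, hq⟩ := t.openCell_nonempty
      obtain ⟨x, hx, rfl⟩ := Cell.exists_norm_eq_one_of_lt hte hq
      have hx' : x = (fun _ => 1) ∨ x = fun _ => -1 := by
        have hxc : x = fun _ => x ⟨0, by omega⟩ := by
          ext j
          congr 1
          apply Fin.ext
          have := j.2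
          simp only
          omega
        have : Nonempty (Fin e.dim) := ⟨⟨0, by omega⟩⟩
        rw [hxc, pi_norm_const, Real.norm_eq_abs] at hx
        rcases (abs_eq zero_le_one).1 hx with h | h
        · left; rw [hxc, h]
        · right; rw [hxc, h]
      rcases hx' with rfl | rfl
      · exact Or.inl (Cell.eq_of_mem hq hr)
      · exact Or.inr (Cell.eq_of_mem hq hr')
    · rintro (rfl | rfl)
      · exact hlt hp hr fun h => by rw [h] at hrd; exact lt_irrefl _ hrd
      · exact hlt hm hr' fun h => by rw [h] at hrd'; exact lt_irrefl _ hrd'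

variable [CWComplex.Finite C]

theorem isRankFunction_closureRank (hn : IsNormal C)
    (hinj : ∀ e : Cell C, InjOn e.charMap (closedBall 0 1)) :
    IsRankFunction (closureRank (C := C)) := by
  refine ⟨rfl, fun u v huv => ?_⟩
  obtain ⟨e, rfl⟩ := WithBot.ne_bot_iff_exists.1 (ne_bot_of_gt huv.lt)
  induction u using WithBot.recBotCoe with
  | bot =>
    by_contra hne
    have hd : e.dim ≠ 0 := fun h => hne (by rw [closureRank_coe, h]; rfl)
    obtain ⟨r, hr, -⟩ := Cell.exists_lt_of_dim_pos hn (hinj e) (Nat.pos_of_ne_zero hd)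
    exact huv.2 (WithBot.bot_lt_coe r) (WithBot.coe_lt_coe.2 hr)
  | coe s =>
    have hse : s < e := WithBot.coe_lt_coe.1 huv.lt
    obtain ⟨r, hsr, hre, hrd⟩ := Cell.exists_facet hn (hinj e) hse
    rcases hsr.eq_or_lt with rfl | h
    · rw [closureRank_coe, closureRank_coe, hrd]
    · exact (huv.2 (WithBot.coe_lt_coe.2 h) (WithBot.coe_lt_coe.2 hre)).elim

theorem exists_Ioo_eq_pair (hn : IsNormal C)
    (hinj : ∀ e : Cell C, InjOn e.charMap (closedBall 0 1)) {s e : Cell C} (hse : s < e)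
    (hd : s.dim + 2 = e.dim) : ∃ r r', r ≠ r' ∧ Ioo s e = {r, r'} := by
  obtain ⟨r, hsr, hre, hrd⟩ := Cell.exists_facet hn (hinj e) hse
  have hsr' := Cell.lt_of_le_of_dim_lt hsr (by omega)
  obtain ⟨r', hne, hsr'', hre'⟩ := Cell.exists_facet_ne hn hinj hsr' hre hd
  refine ⟨r, r', hne.symm, ?_⟩
  ext t
  simp only [mem_insert_iff, mem_singleton_iff]
  constructor
  · rintro ⟨hst, hte⟩
    exact Cell.facet_eq_or_eq hn hinj hd hsr' hre hsr'' hre' hst hte hne.symm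
  · rintro (rfl | rfl)
    · exact ⟨hsr', hre⟩
    · exact ⟨hsr'', hre'⟩

theorem isThin_closureRank (hn : IsNormal C)
    (hinj : ∀ e : Cell C, InjOn e.charMap (closedBall 0 1)) :
    IsThin (closureRank (C := C)) := by
  refine ⟨isRankFunction_closureRank hn hinj, fun u v huv hrk => ?_⟩
  have hlt : u < v := lt_of_le_of_ne huv fun h => by rw [h] at hrk; omega
  rw [ncard_Icc_eq_four_iff hlt]
  obtain ⟨e, rfl⟩ := WithBot.ne_bot_iff_exists.1 (ne_bot_of_gt hlt)
  have hcoe : ∀ (r r' : Cell C) (I : Set (Cell C)), r ≠ r' → I = {r, r'} →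
      ((fun t : Cell C => (t : ClosurePoset C)) '' I).ncard = 2 := by
    rintro r r' I hne rfl
    rw [Set.ncard_image_of_injective _ WithBot.coe_injective, Set.ncard_pair hne]
  induction u using WithBot.recBotCoe with
  | bot =>
    have hd : e.dim + 1 = 0 + 2 := hrk
    obtain ⟨r, r', hne, hI⟩ := exists_Iio_eq_pair hn (hinj e) (by omega)
    rw [← hcoe r r' _ hne hI, WithBot.image_coe_Iio]
  | coe s =>
    rw [closureRank_coe, closureRank_coe] at hrk
    obtain ⟨r, r', hne, hI⟩ := exists_Ioo_eq_pair hn hinj (WithBot.coe_lt_coe.1 hlt)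
      (by omega)
    rw [← hcoe r r' _ hne hI, WithBot.image_coe_Ioo]

theorem isConnectedInterval_of_rank (hn : IsNormal C)
    (hinj : ∀ e : Cell C, InjOn e.charMap (closedBall 0 1)) {u v : ClosurePoset C} (huv : u ≤ v)
    (hrk : closureRank u + 2 < closureRank v) : IsConnectedInterval u v := by
  have hlt : u < v := lt_of_le_of_ne huv fun h => by rw [h] at hrk; omega
  obtain ⟨e, rfl⟩ := WithBot.ne_bot_iff_exists.1 (ne_bot_of_gt hlt)
  rw [closureRank_coe] at hrk
  have hcell : ∀ a ∈ Ioo u (e : ClosurePoset C),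
      ∃ w : Cell C, (w : ClosurePoset C) = a ∧ w < e := by
    rintro a ⟨ha, ha'⟩
    obtain ⟨w, rfl⟩ := WithBot.ne_bot_iff_exists.1 (ne_bot_of_gt ha)
    exact ⟨w, rfl, WithBot.coe_lt_coe.1 ha'⟩
  induction u using WithBot.recBotCoe with
  | bot =>
    have hrk : 0 + 2 < e.dim + 1 := hrk
    obtain ⟨r, hr, -⟩ := Cell.exists_lt_of_dim_pos hn (hinj e) (by omega)
    refine isConnectedInterval_of_forall ⟨r, WithBot.bot_lt_coe r, WithBot.coe_lt_coe.2 hr⟩ ?_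
    intro p hp a ha b hb hpa
    obtain ⟨a, rfl, hae⟩ := hcell a ha
    obtain ⟨b, rfl, hbe⟩ := hcell b hb
    exact Cell.of_compat_lt hn (by omega) (p := fun w => p w) (fun s hs t ht hst =>
      hp s ⟨WithBot.bot_lt_coe s, WithBot.coe_lt_coe.2 hs⟩ t
        ⟨WithBot.bot_lt_coe t, WithBot.coe_lt_coe.2 ht⟩ (WithBot.coe_lt_coe.2 hst)) hae hbe hpa
  | coe s =>
    rw [closureRank_coe] at hrk
    have hse : s < e := WithBot.coe_lt_coe.1 hlt
    have hmem : ∀ {w : Cell C},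
        (w : ClosurePoset C) ∈ Ioo (s : ClosurePoset C) e ↔ w ∈ Ioo s e := by
      intro w
      simp only [mem_Ioo, WithBot.coe_lt_coe]
    obtain ⟨r, hsr, hre, hrd⟩ := Cell.exists_facet hn (hinj e) hse
    refine isConnectedInterval_of_forall
      ⟨r, hmem.2 ⟨Cell.lt_of_le_of_dim_lt hsr (by omega), hre⟩⟩ ?_
    intro p hp a ha b hb hpa
    obtain ⟨a, rfl, -⟩ := hcell a ha
    obtain ⟨b, rfl, -⟩ := hcell b hb
    exact Cell.of_compat_Ioo hn hinj hse (by omega) (p := fun w => p w)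
      (fun w hw t ht hwt => hp w (hmem.2 hw) t (hmem.2 ht) (WithBot.coe_lt_coe.2 hwt))
      (hmem.1 ha) (hmem.1 hb) hpa

end ClosurePoset

end FiniteCW

theorem mainTheorem2 {X : Type*} [TopologicalSpace X] [T2Space X] (C : Set X) [CWComplex C]
    [CWComplex.Finite C] :
    FiniteCW.IsRegular C ↔
      (∀ e : FiniteCW.Cell C, ∃ S : Set (FiniteCW.Cell C),
        e.closedCell = ⋃ s ∈ S, s.openCell) ∧
      (∀ e : FiniteCW.Cell C, e.codimOnePreimage ⊆ sphere 0 1 ∧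
        sphere 0 1 ⊆ closure e.codimOnePreimage) ∧
      (FiniteCW.IsThin (FiniteCW.closureRank (C := C)) ∧
        ∀ u v : FiniteCW.ClosurePoset C, u ≤ v →
          FiniteCW.closureRank u + 2 < FiniteCW.closureRank v →
          FiniteCW.IsConnectedInterval u v) ∧
      (∀ e : FiniteCW.Cell C, InjOn e.charMap e.codimOnePreimage) ∧
      (∀ s e : FiniteCW.Cell C, s.openCell ⊆ closure e.openCell → s.FactorsThrough e) := by
  constructor
  · intro h
    have hn := FiniteCW.isNormal_of_closedCell_eq h.closedCell_eq
    have hinj := h.injOn_charMap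
    refine ⟨h.closedCell_eq, fun e => ⟨fun x => FiniteCW.Cell.mem_sphere_of_mem_codimOnePreimage,
      FiniteCW.Cell.sphere_subset_closure_codimOnePreimage hn (hinj e)⟩,
      ⟨FiniteCW.isThin_closureRank hn hinj, fun u v =>
        FiniteCW.isConnectedInterval_of_rank hn hinj⟩, fun e => (hinj e).mono fun x hx => hx.1,
      fun s e hse => ?_⟩
    exact FiniteCW.Cell.factorsThrough_iff.2 (FiniteCW.Cell.exists_isLift (hinj s) (hinj e) hse)
  · rintro ⟨h1, h2, ⟨h3, h3'⟩, h4, h5⟩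
    exact FiniteCW.isRegular_of_injOn h1 fun e =>
      (FiniteCW.injOn_charMap_of_conditions (FiniteCW.isNormal_of_closedCell_eq h1)
        (fun e => (h2 e).2) h3 h3' h4 h5 e).mono sphere_subset_closedBall
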